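/- **Setting.** Let $n_1,n_2\ge 1$, $n=n_1+n_2$, $g=\frac1{n_1}\sum_{i=1}^{n_1}g_i$ and $h=\frac1{n_2}\sum_{j=1}^{n_2}h_j$ be convex functions on $\mathbb R^d$, where every $g_i$ and the function $h$ are $L$-smooth ($L>0$: differentiable with $L$-Lipschitz gradient) and the $h_j$ are differentiable, and let $r:\mathbb R^d\to\mathbb R\cup\{+\infty\}$ be proper and lower semicontinuous (possibly non-convex and non-smooth). For $\mu>0$ let $r_\mu(x)=\min_y\{\frac1{2\mu}\|y-x\|^2+r(y)\}$, let $\mathrm{prox}_{\mu r}$ be a fixed (arbitrary) selection of minimizers in this problem, and let $F_\mu=g-h+r_\mu$. Let $x_1\in\mathrm{dom}(r)$, and suppose that for some $\Delta,\mu_0>0$ one has $F_\mu(x_1)-\inf F_\mu\le\Delta$ for all $\mu\in(0,\mu_0]$. **Algorithm (SSDC-SVRG).** Given $\mu$, $\gamma_k>0$, $T_k\in\mathbb N$, $S_k=\lceil\log_2 k\rceil$, $\eta=0.05/L$ and $K$, at the stages $k=1,\dots,K$ put $u_k=\nabla h(x_k)+\frac1\mu\mathrm{prox}_{\mu r}(x_k)$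 with $\nabla h=\frac1{n_2}\sum_j\nabla h_j$, and start from $\bar x^{(0)}=x_k$. For $s=1,\dots,S_k$: put $\bar g=\nabla g(\bar x^{(s-1)})-u_k$ and $y_0=\bar x^{(s-1)}$; for $t=1,\dots,T_k$ draw $i_t\in\{1,\dots,n_1\}$ uniformly and independently of the past, put $v_t=\nabla g_{i_t}(y_{t-1})-\nabla g_{i_t}(\bar x^{(s-1)})+\bar g$ and $$y_t=\arg\min_y\ \langle v_t,y-y_{t-1}\rangle+\tfrac1{2\eta}\|y-y_{t-1}\|^2+\tfrac1{2\mu}\|y\|^2+\tfrac{\gamma_k}2\|y-x_k\|^2;$$ then put $\bar x^{(s)}=\frac1{T_k}\sum_{t=1}^{T_k}y_t$. Finally $x_{k+1}=\bar x^{(S_k)}$. The output is $x_\tau$, where $\tau\in\{1,\dots,K\}$ is independent of the run and $P(\tau=k)\propto k^\alpha$ with a fixed $\alpha\ge1$; put $w_\tau=\mathrm{prox}_{\mu r}(x_\tau)$. The gradient complexity is the number of evaluations of component gradients: $n$ per outer iteration $s$ (for $\bar g$) and two per inner iteration $t$. Let $\hat\partial r$ be the Fréchet subdifferential. **Theorem.**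 Let $c>0$, $0<a\le b$ and $B>0$ be constants. (a) Suppose that $r$ is Lipschitz continuous with constant $G$. There are $\varepsilon_0,C>0$, depending only on $L,c,\alpha,\Delta,\mu_0,G,a,b,B$ (in particular not on $n_1,n_2,d$), such that for every $\varepsilon\in(0,\varepsilon_0]$, with $\mu=\varepsilon$, $\gamma_k=ck^{1/3}$, any integers $T_k\ge\max(2,200L/\gamma_k)$, and any integer $K$ with $a\varepsilon^{-3}\le K\le b\varepsilon^{-3}$, $$\mathrm E\|x_\tau-w_\tau\|\le C\varepsilon,\qquad \mathrm E\,\mathrm{dist}\big(\nabla h(w_\tau),\nabla g(w_\tau)+\hat\partial r(w_\tau)\big)\le C\varepsilon,$$ and, if moreover $T_k\le Bn$ for all $k\le K$, the gradient complexity is at most $C\,\frac{n}{\varepsilon^3}\log\frac1\varepsilon$ (so it is $\widetilde O(n/\varepsilon^3)$). (b) Suppose that either $r$ is lower bounded and finite-valued on $\mathbb R^d$, or $r$ is lower bounded, finite-valued on some nonempty compact set, and $F_\mu$ is level bounded (has bounded sublevel sets) for some $\mu\in(0,1)$. Let $M\ge r(x_1)-\inf r$. There are $\varepsilon_0,C>0$,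 depending only on $L,c,\alpha,\Delta,\mu_0,M,a,b,B$, such that for every $\varepsilon\in(0,\varepsilon_0]$, with $\mu=\varepsilon^2$, $\gamma_k=ck^{1/2}$, any integers $T_k\ge\max(2,200L/\gamma_k)$, and any integer $K$ with $a\varepsilon^{-4}\le K\le b\varepsilon^{-4}$, the same two bounds on expectations hold, and, if moreover $T_k\le Bn$ for all $k\le K$, the gradient complexity is at most $C\,\frac{n}{\varepsilon^4}\log\frac1\varepsilon$ (so it is $\widetilde O(n/\varepsilon^4)$). -/

import Mathlib

open Filter Topology
open scoped ENNReal Gradient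

noncomputable section

namespace SSDC

/-- `ℝ^d` with the Euclidean norm. -/
abbrev Vec (d : ℕ) : Type := EuclideanSpace ℝ (Fin d)

/-! ### Deterministic notions -/

/-- The finite-sum function `x ↦ (1/n) ∑ i, f i x`. -/
def avg {d n : ℕ} (f : Fin n → Vec d → ℝ) (x : Vec d) : ℝ :=
  (n : ℝ)⁻¹ * ∑ i, f i x

/-- `f` is differentiable with an `L`-Lipschitz continuous gradient. -/
def IsSmooth {d : ℕ} (L : ℝ) (f : Vec d → ℝ) : Prop :=
  Differentiable ℝ f ∧ ∀ x y, ‖∇ f x - ∇ f y‖ ≤ L * ‖x - y‖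

/-- A (chosen) minimizer of a function over `ℝ^d`. -/
def argminPoint {d : ℕ} (φ : Vec d → ℝ) : Vec d :=
  Classical.epsilon fun x => ∀ y, φ x ≤ φ y

/-- The objective `y ↦ ‖y - x‖² / (2μ) + r y` of the proximal problem. -/
def proxObjective {d : ℕ} (μ : ℝ) (r : Vec d → EReal) (x y : Vec d) : EReal :=
  ((‖y - x‖ ^ 2 / (2 * μ) : ℝ) : EReal) + r y

/-- The proximal mapping (set valued, since `r` need not be convex):
all minimizers of the proximal problem. -/
def proxSet {d : ℕ} (μ : ℝ) (r : Vec d → EReal) (x : Vec d) : Set (Vec d) :=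
  {y | ∀ z, proxObjective μ r x y ≤ proxObjective μ r x z}

/-- The Moreau envelope `r_μ`. -/
def moreau {d : ℕ} (μ : ℝ) (r : Vec d → EReal) (x : Vec d) : EReal :=
  ⨅ y, proxObjective μ r x y

/-- The smoothed objective `F_μ = g - h + r_μ`. -/
def smoothed {d : ℕ} (μ : ℝ) (g h : Vec d → ℝ) (r : Vec d → EReal) (x : Vec d) : EReal :=
  ((g x - h x : ℝ) : EReal) + moreau μ r x

/-- The Fréchet subdifferential of an extended-real-valued function at a point where it is finite
(it is empty elsewhere). The last clause says
`liminf_{y → x} (r y - r x - ⟪v, y - x⟫) / ‖y - x‖ ≥ 0`, with the denominator cleared. -/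
def frechetSubdiff {d : ℕ} (r : Vec d → EReal) (x : Vec d) : Set (Vec d) :=
  {v | r x ≠ ⊤ ∧ r x ≠ ⊥ ∧ ∀ δ : ℝ, 0 < δ → ∀ᶠ y in 𝓝 x,
    r x + ((inner ℝ v (y - x) - δ * ‖y - x‖ : ℝ) : EReal) ≤ r y}

/-- `dist (∇h(w), ∇g(w) + ∂̂r(w))`; it is `∞` if the set is empty. -/
def criticality {d : ℕ} (g h : Vec d → ℝ) (r : Vec d → EReal) (w : Vec d) : ℝ≥0∞ :=
  Metric.infEDist (∇ h w) ((fun v => ∇ g w + v) '' frechetSubdiff r w)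

/-! ### Assumptions on the problem `min g - h + r` -/

/-- Standing assumptions: `g` and `h` are finite sums and convex, every component of `g` is
`L`-smooth, `h` is `L`-smooth with components that have gradients, and `r` is proper and lower
semicontinuous. -/
structure IsProblem {d n₁ n₂ : ℕ} (L : ℝ) (g : Fin n₁ → Vec d → ℝ) (h : Fin n₂ → Vec d → ℝ)
    (r : Vec d → EReal) : Prop where
  convex_g : ConvexOn ℝ Set.univ (avg g)
  convex_h : ConvexOn ℝ Set.univ (avg h)
  smooth_g : ∀ i, IsSmooth L (g i)
  smooth_h : IsSmooth L (avg h)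
  differentiable_h : ∀ j, Differentiable ℝ (h j)
  lsc_r : LowerSemicontinuous r
  ne_bot_r : ∀ x, r x ≠ ⊥
  proper_r : ∃ x, r x ≠ ⊤

/-- The initial gap of `F_μ` is at most `Δ`, for all `μ ∈ (0, μ₀]`. -/
def InitialGap {d : ℕ} (μ₀ Δ : ℝ) (g h : Vec d → ℝ) (r : Vec d → EReal) (x₁ : Vec d) : Prop :=
  ∀ μ : ℝ, 0 < μ → μ ≤ μ₀ → ∀ x, smoothed μ g h r x₁ ≤ smoothed μ g h r x + (Δ : EReal)

/-- `r` is Lipschitz continuous with constant `G`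
(for a proper `r` this forces `r` to be finite everywhere). -/
def IsLipschitz {d : ℕ} (G : ℝ) (r : Vec d → EReal) : Prop :=
  ∀ x y, r x ≤ r y + ((G * ‖x - y‖ : ℝ) : EReal)

/-- `r` is bounded below by a real number. -/
def IsLowerBounded {d : ℕ} (r : Vec d → EReal) : Prop :=
  ∃ m : ℝ, ∀ x, (m : EReal) ≤ r x

/-- All sublevel sets are bounded. -/
def IsLevelBounded {d : ℕ} (F : Vec d → EReal) : Prop :=
  ∀ t : ℝ, Bornology.IsBounded {x | F x ≤ (t : EReal)}

/-- `r` is lower bounded and finite-valued over `ℝ^d`. -/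
def FiniteLowerBounded {d : ℕ} (r : Vec d → EReal) : Prop :=
  IsLowerBounded r ∧ ∀ x, r x ≠ ⊤

/-- `g - h + r_μ` is level bounded for some `μ < 1`, and `r` is finite-valued on a (nonempty)
compact set and lower bounded over `ℝ^d`. -/
def LevelBoundedCase {d : ℕ} (g h : Vec d → ℝ) (r : Vec d → EReal) : Prop :=
  (∃ μ : ℝ, 0 < μ ∧ μ < 1 ∧ IsLevelBounded (smoothed μ g h r)) ∧
    (∃ A : Set (Vec d), IsCompact A ∧ A.Nonempty ∧ ∀ x ∈ A, r x ≠ ⊤) ∧ IsLowerBounded r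

/-! ### The algorithms, as probabilistic programs that count component gradient evaluations -/

/-- Expectation of a nonnegative function of the outcome of a probabilistic program. -/
def expect {Ω : Type} (p : PMF Ω) (φ : Ω → ℝ≥0∞) : ℝ≥0∞ :=
  ∑' ω, p ω * φ ω

/-- State of the inner loop of SVRG: the current point `x_t`, the sum `x_1 + ⋯ + x_t`, and the
number of component gradient evaluations so far. -/
structure InnerState (d : ℕ) where
  point : Vec d
  total : Vec d
  count : ℕ

/-- `t` inner iterations of SVRG with step size `η` for the regularizer
`rhat + (γ/2) ‖· - x₁‖²`, from the reference point `xbar` with reference gradient `gbar`.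
Every iteration evaluates two component gradients of `g`. -/
def svrgInner {d n₁ : ℕ} [NeZero n₁] (g : Fin n₁ → Vec d → ℝ) (rhat : Vec d → ℝ) (γ η : ℝ)
    (x₁ xbar gbar : Vec d) : ℕ → PMF (InnerState d)
  | 0 => PMF.pure ⟨xbar, 0, 0⟩
  | t + 1 =>
    (svrgInner g rhat γ η x₁ xbar gbar t).bind fun st =>
      (PMF.uniformOfFintype (Fin n₁)).map fun i =>
        let v : Vec d := ∇ (g i) st.point - ∇ (g i) xbar + gbar
        let x : Vec d := argminPoint fun y =>
          inner ℝ v (y - st.point) + 1 / (2 * η) * ‖y - st.point‖ ^ 2 + rhat y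
            + γ / 2 * ‖y - x₁‖ ^ 2
        ⟨x, st.total + x, st.count + 2⟩

/-- `S` outer loops of SVRG with `T` inner iterations each, started at `x₁`, for the convex
majorant `g + rhat - ⟪∂h x₁, · - x₁⟫ + (γ/2) ‖· - x₁‖²` (up to an additive constant).
The subgradient oracle for the subtracted function is `dh`, with cost `n₂` per call.
The outcome is the returned point and the number of component gradient evaluations. -/
def svrg {d n₁ : ℕ} [NeZero n₁] (g : Fin n₁ → Vec d → ℝ) (n₂ : ℕ) (dh : Vec d → Vec d)
    (rhat : Vec d → ℝ) (γ η : ℝ) (T : ℕ) (x₁ : Vec d) : ℕ → PMF (Vec d × ℕ)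
  | 0 => PMF.pure (x₁, 0)
  | s + 1 =>
    (svrg g n₂ dh rhat γ η T x₁ s).bind fun st =>
      let gbar : Vec d := (n₁ : ℝ)⁻¹ • (∑ i, ∇ (g i) st.1) - dh x₁
      (svrgInner g rhat γ η x₁ st.1 gbar T).map fun o =>
        ((T : ℝ)⁻¹ • o.total, st.2 + (n₁ + n₂) + o.count)

/-- The subgradient of `h + R_μ` used by the algorithm, where `r_μ = ‖·‖²/(2μ) - R_μ`: the average
of the component gradients of `h`, plus `(1/μ) prox_{μ r}`, with `prox` a selection of the
proximal mapping. -/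
def subgrad {d n₂ : ℕ} (h : Fin n₂ → Vec d → ℝ) (μ : ℝ) (prox : Vec d → Vec d) (x : Vec d) :
    Vec d :=
  (n₂ : ℝ)⁻¹ • (∑ j, ∇ (h j) x) + μ⁻¹ • prox x

/-- The first `k` stages of SSDC-SVRG applied to
`(g + ‖·‖²/(2μ)) - (h + R_μ)`, with stage parameters `γ k`, `T k`, `S k` (`k ≥ 1`) and step size
`η`. The outcome is the sequence of iterates `x_1, …, x_{k+1}` (entries at other indices are
irrelevant) and the number of component gradient evaluations. -/
def stages {d n₁ n₂ : ℕ} [NeZero n₁] (g : Fin n₁ → Vec d → ℝ) (h : Fin n₂ → Vec d → ℝ) (μ : ℝ)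
    (prox : Vec d → Vec d) (γ : ℕ → ℝ) (η : ℝ) (T S : ℕ → ℕ) (x₁ : Vec d) :
    ℕ → PMF ((ℕ → Vec d) × ℕ)
  | 0 => PMF.pure (fun _ => x₁, 0)
  | k + 1 =>
    (stages g h μ prox γ η T S x₁ k).bind fun st =>
      (svrg g n₂ (subgrad h μ prox) (fun y => 1 / (2 * μ) * ‖y‖ ^ 2) (γ (k + 1)) η (T (k + 1))
        (st.1 (k + 1)) (S (k + 1))).map fun o =>
          (Function.update st.1 (k + 2) o.1, st.2 + o.2)

/-- The law of `τ - 1` where `τ ∈ {1, …, K}` has `P(τ = k)` proportional to `k ^ α`. -/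
def tauLaw (K : ℕ) [NeZero K] (α : ℝ) : PMF (Fin K) :=
  PMF.normalize (fun i : Fin K => ENNReal.ofReal (((i : ℕ) + 1 : ℝ) ^ α))
    (by
      rw [tsum_fintype]
      refine fun h0 => ?_
      have h1 := (Finset.sum_eq_zero_iff.mp h0) (0 : Fin K) (Finset.mem_univ _)
      rw [ENNReal.ofReal_eq_zero] at h1
      exact absurd h1 (not_le.mpr (Real.rpow_pos_of_pos (by positivity) α)))
    (by
      rw [tsum_fintype]
      exact ENNReal.sum_ne_top.mpr fun _ _ => ENNReal.ofReal_ne_top)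

/-- SSDC-SVRG with `K` stages, `η = 0.05 / L` and `S k = ⌈log₂ k⌉`: it returns `x_τ`,
together with the total number of component gradient evaluations over the `K` stages. -/
def ssdcSVRG {d n₁ n₂ : ℕ} [NeZero n₁] (L : ℝ) (g : Fin n₁ → Vec d → ℝ) (h : Fin n₂ → Vec d → ℝ)
    (μ : ℝ) (prox : Vec d → Vec d) (γ : ℕ → ℝ) (T : ℕ → ℕ) (α : ℝ) (x₁ : Vec d)
    (K : ℕ) [NeZero K] : PMF (Vec d × ℕ) :=
  (stages g h μ prox γ (0.05 / L) T (fun k => ⌈Real.logb 2 k⌉₊) x₁ K).bind fun st =>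
    (tauLaw K α).map fun i => (st.1 ((i : ℕ) + 1), st.2)

end SSDC

end

namespace SSDC

variable {d n₁ n₂ : ℕ}

/-! ### Gradients of averages and of convex functions -/

/-! For small `μ` the quadratic `‖·‖²/(2μ)` dominates the smooth part: once `1000 L μ ≤ 1`, every
inner step lands within `1/10` of the distance from the reference point to the minimizer `z` of the
stage's majorant, whatever component is drawn (`mem_support_svrgInner`). No variance estimate is
needed: the stages are analysed along each run, and only the law of `τ` is averaged.

Write `σ_k = 1/μ + γ_k`. A stage from `x` with at least one outer loop lowers `F_μ` by at least `σ_k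
‖x - z‖² / 4` (`objective_descent`), while the criticality at `prox x` is at most `2L ‖x - prox x‖ +
q_k` with `q_k = 2 σ_k ‖x - z‖` (`criticality_prox_le`). Telescoping bounds the sum of the `q_k²` by
a multiple of `max σ_k · Δ`. With `μ = ε^m`, `K` of order `ε^{-(m+2)}` and `γ_k` at most of order
`ε^{-m}`, the mean of `q_k²` is `O(ε²)`. Since `τ` has no atom larger than `2^{α+1}/K`, the
expectation of `q_τ` is `O(ε)`.

The displacement `‖x - prox x‖` is `O(ε)` on the initial sublevel set, which no run leaves: by the
Lipschitz bound when `μ = ε`, and by comparing the envelopes for `μ` and `2μ` when `μ = ε²`. -/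

theorem hasGradientAt_avg {n : ℕ} {f : Fin n → Vec d → ℝ} (hf : ∀ i, Differentiable ℝ (f i))
    (x : Vec d) : HasGradientAt (avg f) ((n : ℝ)⁻¹ • ∑ i, ∇ (f i) x) x := by
  rw [hasGradientAt_iff_hasFDerivAt]
  have h1 : HasFDerivAt (fun y => ∑ i, f i y) (∑ i, fderiv ℝ (f i) x) x :=
    HasFDerivAt.fun_sum fun i _ => (hf i x).hasFDerivAt
  have h2 := h1.const_mul (n : ℝ)⁻¹
  refine h2.congr_fderiv ?_
  rw [map_smulₛₗ, map_sum]
  simp [toDual_gradient]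

theorem differentiable_avg {n : ℕ} {f : Fin n → Vec d → ℝ} (hf : ∀ i, Differentiable ℝ (f i)) :
    Differentiable ℝ (avg f) :=
  fun x => (hasGradientAt_avg hf x).differentiableAt

theorem gradient_avg {n : ℕ} {f : Fin n → Vec d → ℝ} (hf : ∀ i, Differentiable ℝ (f i))
    (x : Vec d) : ∇ (avg f) x = (n : ℝ)⁻¹ • ∑ i, ∇ (f i) x :=
  (hasGradientAt_avg hf x).gradient

/-- An average of `L`-smooth functions is `L`-smooth. -/
theorem isSmooth_avg {n : ℕ} [NeZero n] {L : ℝ} {f : Fin n → Vec d → ℝ}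
    (hf : ∀ i, IsSmooth L (f i)) : IsSmooth L (avg f) := by
  refine ⟨differentiable_avg fun i => (hf i).1, fun x y => ?_⟩
  have hn : (0 : ℝ) < n := by exact_mod_cast Nat.pos_of_ne_zero (NeZero.ne n)
  rw [gradient_avg (fun i => (hf i).1), gradient_avg (fun i => (hf i).1), ← smul_sub,
    ← Finset.sum_sub_distrib, norm_smul, Real.norm_of_nonneg (by positivity)]
  have h1 : ‖∑ i, (∇ (f i) x - ∇ (f i) y)‖ ≤ ∑ _i : Fin n, L * ‖x - y‖ :=
    norm_sum_le_of_le _ fun i _ => (hf i).2 x y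
  rw [Finset.sum_const, Finset.card_univ, Fintype.card_fin, nsmul_eq_mul] at h1
  calc (n : ℝ)⁻¹ * ‖∑ i, (∇ (f i) x - ∇ (f i) y)‖ ≤ (n : ℝ)⁻¹ * (n * (L * ‖x - y‖)) := by gcongr
    _ = L * ‖x - y‖ := by field_simp

/-- The gradient inequality for convex functions. -/
theorem add_inner_gradient_le {f : Vec d → ℝ} (hc : ConvexOn ℝ Set.univ f)
    (hd : Differentiable ℝ f) (x y : Vec d) : f x + inner ℝ (∇ f x) (y - x) ≤ f y := by
  have hline : HasDerivAt (fun t : ℝ => x + t • (y - x)) (y - x) 0 := by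
    simpa using ((hasDerivAt_id (0 : ℝ)).smul_const (y - x)).const_add x
  have hfx : HasFDerivAt f (fderiv ℝ f x) (x + (0 : ℝ) • (y - x)) := by
    simpa using (hd x).hasFDerivAt
  have h1 : HasDerivAt (fun t : ℝ => f (x + t • (y - x))) (fderiv ℝ f x (y - x)) 0 :=
    hfx.comp_hasDerivAt (0 : ℝ) hline
  have h2 : ConvexOn ℝ Set.univ (fun t : ℝ => f (x + t • (y - x))) := by
    have := hc.comp_affineMap (AffineMap.lineMap x y : ℝ →ᵃ[ℝ] Vec d)
    simp only [Set.preimage_univ] at this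
    refine this.congr fun t _ => ?_
    simp [AffineMap.lineMap_apply, add_comm]
  have h3 := h2.le_slope_of_hasDerivAt (Set.mem_univ 0) (Set.mem_univ 1) zero_lt_one h1
  rw [slope_def_field] at h3
  simp only [one_smul, zero_smul, add_zero, sub_zero, div_one, add_sub_cancel] at h3
  rw [inner_gradient_left]
  linarith

/-- A convex `L`-smooth function lies below its tangent plus `L ‖y - z‖²`. -/
theorem le_add_inner_gradient_add {L : ℝ} {f : Vec d → ℝ}
    (hc : ConvexOn ℝ Set.univ f) (hf : IsSmooth L f) (z y : Vec d) :
    f y ≤ f z + inner ℝ (∇ f z) (y - z) + L * ‖y - z‖ ^ 2 := by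
  -- The tangent is taken at `y`; moving its gradient to `z` costs `L ‖y - z‖²`. This is twice the
  -- sharp constant, but needs no integration.
  have h1 := add_inner_gradient_le hc hf.1 y z
  have h2 : inner ℝ (∇ f y - ∇ f z) (y - z) ≤ L * ‖y - z‖ * ‖y - z‖ :=
    (real_inner_le_norm _ _).trans (by gcongr; exact hf.2 y z)
  rw [inner_sub_left] at h2
  rw [← neg_sub y z, inner_neg_right] at h1
  nlinarith

/-! ### Argmin of the inner quadratic -/

/-- The minimizer of the quadratic model of one inner step of SVRG. -/
theorem argminPoint_quadratic {η μ γ : ℝ} (hη : 0 < η) (hμ : 0 < μ) (hγ : 0 ≤ γ)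
    (v p x : Vec d) :
    (η⁻¹ + μ⁻¹ + γ) • argminPoint (fun y : Vec d => inner ℝ v (y - p) + 1 / (2 * η) * ‖y - p‖ ^ 2
      + 1 / (2 * μ) * ‖y‖ ^ 2 + γ / 2 * ‖y - x‖ ^ 2) = η⁻¹ • p - v + γ • x := by
  set φ : Vec d → ℝ := fun y => inner ℝ v (y - p) + 1 / (2 * η) * ‖y - p‖ ^ 2
      + 1 / (2 * μ) * ‖y‖ ^ 2 + γ / 2 * ‖y - x‖ ^ 2 with hφ
  have hs : 0 < η⁻¹ + μ⁻¹ + γ := by positivity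
  set s := η⁻¹ + μ⁻¹ + γ with hsdef
  set q : Vec d := s⁻¹ • (η⁻¹ • p - v + γ • x) with hq
  have hsq : s • q = η⁻¹ • p - v + γ • x := by rw [hq, smul_inv_smul₀ hs.ne']
  -- Completing the square shows both that a minimizer exists, without which `Classical.epsilon`
  -- says nothing, and that it is unique.
  have key : ∀ y, φ y = φ q + s / 2 * ‖y - q‖ ^ 2 := by
    intro y
    have h1 : inner ℝ (s • q) (y - q) = inner ℝ (η⁻¹ • p - v + γ • x) (y - q) := by rw [hsq]
    obtain ⟨a, rfl⟩ : ∃ a, y = q + a := ⟨y - q, by abel⟩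
    simp only [hφ]
    have e1 : q + a - p = (q - p) + a := by abel
    have e2 : q + a - x = (q - x) + a := by abel
    rw [add_sub_cancel_left] at h1 ⊢
    rw [e1, e2, norm_add_sq_real (q - p), norm_add_sq_real (q - x), norm_add_sq_real q]
    simp only [inner_add_left, inner_sub_left, inner_smul_left, inner_add_right,
      RCLike.conj_to_real] at h1 ⊢
    rw [one_div, one_div, mul_inv, mul_inv]
    rw [hsdef] at h1 ⊢
    linear_combination h1
  have hmin : ∀ y, φ (argminPoint φ) ≤ φ y :=
    Classical.epsilon_spec (p := fun x => ∀ y, φ x ≤ φ y)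
      ⟨q, fun y => by rw [key y]; nlinarith [sq_nonneg ‖y - q‖]⟩
  have h0 := hmin q
  rw [key (argminPoint φ)] at h0
  have h1 : ‖argminPoint φ - q‖ ^ 2 ≤ 0 := by nlinarith
  have h2 : argminPoint φ = q := by
    rw [← sub_eq_zero, ← norm_eq_zero]
    exact pow_eq_zero_iff (two_ne_zero) |>.mp (le_antisymm h1 (sq_nonneg _))
  rw [h2, hsq]

/-! ### The proximal problem -/

/-- The value of the proximal problem at the selected minimizer. -/
noncomputable def envelope (μ : ℝ) (r : Vec d → EReal) (prox : Vec d → Vec d) (x : Vec d) : ℝ :=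
  ‖prox x - x‖ ^ 2 / (2 * μ) + (r (prox x)).toReal

section Prox

variable {μ : ℝ} {r : Vec d → EReal} {prox : Vec d → Vec d}

theorem apply_ne_top_of_mem_proxSet (hr : ∃ x, r x ≠ ⊤) {x w : Vec d} (hw : w ∈ proxSet μ r x) :
    r w ≠ ⊤ := by
  obtain ⟨y, hy⟩ := hr
  intro h
  have h1 := hw y
  simp only [proxObjective, h, EReal.coe_add_top, top_le_iff] at h1
  exact EReal.add_ne_top (EReal.coe_ne_top _) hy h1

theorem moreau_eq_envelope (hbot : ∀ x, r x ≠ ⊥) (hr : ∃ x, r x ≠ ⊤)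
    (hprox : ∀ x, prox x ∈ proxSet μ r x) (x : Vec d) : moreau μ r x = envelope μ r prox x := by
  have h1 : moreau μ r x = proxObjective μ r x (prox x) :=
    le_antisymm (iInf_le _ _) (le_iInf (hprox x))
  rw [h1, proxObjective, envelope, EReal.coe_add,
    EReal.coe_toReal (apply_ne_top_of_mem_proxSet hr (hprox x)) (hbot _)]

theorem envelope_le (hbot : ∀ x, r x ≠ ⊥) (hr : ∃ x, r x ≠ ⊤)
    (hprox : ∀ x, prox x ∈ proxSet μ r x) (x y : Vec d) (hy : r y ≠ ⊤) :
    envelope μ r prox x ≤ ‖y - x‖ ^ 2 / (2 * μ) + (r y).toReal := by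
  rw [← EReal.coe_le_coe_iff, ← moreau_eq_envelope hbot hr hprox, EReal.coe_add,
    EReal.coe_toReal hy (hbot _)]
  exact iInf_le _ _

/-- A proximal point `w` of `x` satisfies `(x - w) / μ ∈ ∂̂ r w`. -/
theorem inv_smul_sub_mem_frechetSubdiff (hμ : 0 < μ) (hbot : ∀ x, r x ≠ ⊥) (hr : ∃ x, r x ≠ ⊤)
    {x w : Vec d} (hw : w ∈ proxSet μ r x) : μ⁻¹ • (x - w) ∈ frechetSubdiff r w := by
  have hwt := apply_ne_top_of_mem_proxSet hr hw
  refine ⟨hwt, hbot w, fun δ hδ => ?_⟩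
  -- Minimality of `w` gives the subgradient inequality up to `‖y - w‖² / (2μ)`, which this radius
  -- makes at most `δ ‖y - w‖`.
  have hball : ∀ᶠ y in 𝓝 w, dist y w < 2 * μ * δ := Metric.ball_mem_nhds w (by positivity)
  filter_upwards [hball] with y hy
  by_cases hyt : r y = ⊤
  · rw [hyt]; exact le_top
  have h1 := hw y
  simp only [proxObjective] at h1
  rw [← EReal.coe_toReal hwt (hbot w), ← EReal.coe_toReal hyt (hbot y)] at h1 ⊢
  norm_cast at h1 ⊢
  rw [dist_eq_norm] at hy
  have e1 : y - x = (w - x) + (y - w) := by abel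
  rw [e1, norm_add_sq_real] at h1
  rw [real_inner_smul_left, ← neg_sub w x, inner_neg_left]
  have h2 : ‖y - w‖ ^ 2 / (2 * μ) ≤ δ * ‖y - w‖ := by
    rw [div_le_iff₀ (by positivity)]
    nlinarith [norm_nonneg (y - w)]
  have h3 : (‖w - x‖ ^ 2 + 2 * inner ℝ (w - x) (y - w) + ‖y - w‖ ^ 2) / (2 * μ)
      = ‖w - x‖ ^ 2 / (2 * μ) + μ⁻¹ * inner ℝ (w - x) (y - w) + ‖y - w‖ ^ 2 / (2 * μ) := by
    field_simp
  rw [h3] at h1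
  linarith

end Prox

/-! ### The majorant of one stage: its minimizer, descent and criticality. -/

/-- `g - h + r_μ` as a real-valued function. -/
noncomputable def objective (μ : ℝ) (g : Fin n₁ → Vec d → ℝ) (h : Fin n₂ → Vec d → ℝ) (r : Vec d → EReal)
    (prox : Vec d → Vec d) (x : Vec d) : ℝ :=
  avg g x - avg h x + envelope μ r prox x

/-- The stationarity condition of the minimizer `z` of the convex majorant of a stage that starts
at `x` with subgradient `u`. -/
def IsStageMin (μ γ : ℝ) (g : Fin n₁ → Vec d → ℝ) (u x z : Vec d) : Prop :=
  ∇ (avg g) z + μ⁻¹ • z + γ • (z - x) = u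

/-- Solved for `z`, the stationarity equation is a fixed-point equation whose map has Lipschitz
constant `L / (1/μ + γ) < 1`, so Banach's theorem applies. -/
theorem exists_isStageMin {L μ γ : ℝ} (hL : 0 < L) (hμ : 0 < μ) (hγ : 0 ≤ γ)
    (hLμ : L * μ < 1) {g : Fin n₁ → Vec d → ℝ} (hg : IsSmooth L (avg g)) (u x : Vec d) :
    ∃ z, IsStageMin μ γ g u x z := by
  have hs : 0 < μ⁻¹ + γ := by positivity
  set s := μ⁻¹ + γ with hsdef
  have hLs : L < s := by
    have : L < μ⁻¹ := by rwa [lt_inv_comm₀ hL hμ, ← one_div, lt_div_iff₀ hL, mul_comm]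
    linarith
  let Φ : Vec d → Vec d := fun z => s⁻¹ • (u + γ • x - ∇ (avg g) z)
  have hΦ : ContractingWith (L / s).toNNReal Φ := by
    refine ⟨?_, LipschitzWith.of_dist_le_mul fun y z => ?_⟩
    · rw [Real.toNNReal_lt_one]
      exact (div_lt_one hs).mpr hLs
    · rw [Real.coe_toNNReal _ (by positivity), dist_eq_norm, dist_eq_norm, ← smul_sub, norm_smul,
        Real.norm_of_nonneg (by positivity : 0 ≤ s⁻¹), sub_sub_sub_cancel_left]
      have := hg.2 z y
      rw [norm_sub_rev z y] at this
      calc s⁻¹ * ‖∇ (avg g) z - ∇ (avg g) y‖ ≤ s⁻¹ * (L * ‖y - z‖) := by gcongr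
        _ = L / s * ‖y - z‖ := by ring
  refine ⟨hΦ.fixedPoint, ?_⟩
  have hz : Φ hΦ.fixedPoint = hΦ.fixedPoint := hΦ.fixedPoint_isFixedPt
  generalize hΦ.fixedPoint = z at hz
  have h1 : s • z = u + γ • x - ∇ (avg g) z := by
    rw [← hz, smul_inv_smul₀ hs.ne', hz]
  rw [hsdef, add_smul] at h1
  rw [IsStageMin, smul_sub]
  have : μ⁻¹ • z = u + γ • x - ∇ (avg g) z - γ • z := by rw [← h1]; abel
  rw [this]; abel

section Stage

variable {L μ γ : ℝ} {g : Fin n₁ → Vec d → ℝ} {h : Fin n₂ → Vec d → ℝ} {r : Vec d → EReal}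
  {prox : Vec d → Vec d}

theorem subgrad_eq (hh : ∀ j, Differentiable ℝ (h j)) (x : Vec d) :
    subgrad h μ prox x = ∇ (avg h) x + μ⁻¹ • prox x := by
  rw [subgrad, gradient_avg hh]

/-- Descent of the objective over a stage that ends near the minimizer of the majorant. -/
theorem objective_descent [NeZero n₁] (hμ : 0 < μ) (hγ : 0 ≤ γ)
    (hLμ : 1000 * (L * μ) ≤ 1)
    (hP : IsProblem L g h r) (hprox : ∀ x, prox x ∈ proxSet μ r x) {x y z : Vec d}
    (hz : IsStageMin μ γ g (subgrad h μ prox x) x z) (hyz : ‖y - z‖ ≤ 1 / 10 * ‖x - z‖) :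
    (μ⁻¹ + γ) / 4 * ‖x - z‖ ^ 2 ≤ objective μ g h r prox x - objective μ g h r prox y := by
  have hg := isSmooth_avg hP.smooth_g
  rw [IsStageMin, subgrad_eq hP.differentiable_h] at hz
  have h1 := le_add_inner_gradient_add hP.convex_g hg z y
  have h2 := add_inner_gradient_le hP.convex_g hg.1 z x
  have h3 := add_inner_gradient_le hP.convex_h hP.smooth_h.1 x y
  -- Testing the envelope at `y` with the old point `prox x` replaces the subgradient inequality for
  -- the convex function `R_μ`.
  have h4 := envelope_le hP.ne_bot_r hP.proper_r hprox y (prox x)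
    (apply_ne_top_of_mem_proxSet hP.proper_r (hprox x))
  have hx : envelope μ r prox x = ‖prox x - x‖ ^ 2 / (2 * μ) + (r (prox x)).toReal := rfl
  have hin := congrArg (fun v => inner ℝ v (y - x)) hz
  obtain ⟨A, rfl⟩ : ∃ A, y = z + A := ⟨y - z, by abel⟩
  obtain ⟨b, rfl⟩ : ∃ b, x = z + b := ⟨x - z, by abel⟩
  generalize prox (z + b) = w at *
  have e1 : z + A - (z + b) = A - b := by abel
  have e2 : z - (z + b) = -b := by abel
  have e3 : w - (z + A) = (w - z) - A := by abel
  have e4 : w - (z + b) = (w - z) - b := by abel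
  simp only [add_sub_cancel_left] at h1 h2 hyz ⊢
  rw [e3, norm_sub_sq_real (w - z) A] at h4
  rw [e4, norm_sub_sq_real (w - z) b] at hx
  rw [e1] at hin h3
  rw [e2] at hin
  simp only [inner_add_left, inner_sub_left, inner_smul_left, inner_neg_left, inner_sub_right,
    RCLike.conj_to_real, real_inner_self_eq_norm_sq, smul_neg] at hin h3 h4 hx
  have hAb : inner ℝ b A ≤ ‖b‖ * (1 / 10 * ‖b‖) :=
    (real_inner_le_norm b A).trans (by gcongr)
  have hA2 : ‖A‖ ^ 2 ≤ 1 / 100 * ‖b‖ ^ 2 := by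
    calc ‖A‖ ^ 2 ≤ (1 / 10 * ‖b‖) ^ 2 := by gcongr
      _ = _ := by ring
  have hLm : L ≤ μ⁻¹ / 1000 := by
    rw [le_div_iff₀ (by norm_num), ← one_div, le_div_iff₀ hμ]; linarith
  simp only [objective]
  have hdiv : ∀ a c : ℝ, a / (2 * μ) + c = μ⁻¹ * a / 2 + c := fun a c => by
    rw [div_eq_mul_inv, mul_inv]; ring
  rw [hdiv] at h4 hx
  have hm : 0 < μ⁻¹ := by positivity
  generalize μ⁻¹ = m at *
  -- The inequalities add up to a decrease of at least `(m/2 + γ) ‖b‖² - γ ⟪b, A⟫ - (m/2 + L) ‖A‖²`;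
  -- `‖A‖ ≤ ‖b‖/10` leaves more than `(m + γ)/4 · ‖b‖²`.
  have k1 : L * ‖A‖ ^ 2 ≤ m / 1000 * (1 / 100 * ‖b‖ ^ 2) := by gcongr
  have k2 : m * ‖A‖ ^ 2 ≤ m * (1 / 100 * ‖b‖ ^ 2) := by gcongr
  have k3 : γ * inner ℝ b A ≤ γ * (‖b‖ * (1 / 10 * ‖b‖)) := by gcongr
  have k4 : 0 ≤ γ * ‖b‖ ^ 2 := by positivity
  have k5 : 0 ≤ m * ‖b‖ ^ 2 := by positivity
  nlinarith

/-- The criticality measure at the proximal point of the start of a stage. -/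
theorem criticality_prox_le [NeZero n₁] (hL : 0 < L) (hμ : 0 < μ) (hγ : 0 ≤ γ)
    (hLμ : 1000 * (L * μ) ≤ 1)
    (hP : IsProblem L g h r) (hprox : ∀ x, prox x ∈ proxSet μ r x) {x z : Vec d}
    (hz : IsStageMin μ γ g (subgrad h μ prox x) x z) :
    criticality (avg g) (avg h) r (prox x)
      ≤ ENNReal.ofReal (2 * L * ‖x - prox x‖ + 2 * ((μ⁻¹ + γ) * ‖x - z‖)) := by
  have hg := isSmooth_avg hP.smooth_g
  rw [IsStageMin, subgrad_eq hP.differentiable_h] at hz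
  have hmem := inv_smul_sub_mem_frechetSubdiff hμ hP.ne_bot_r hP.proper_r (hprox x)
  refine (Metric.infEDist_le_edist_of_mem (Set.mem_image_of_mem _ hmem)).trans ?_
  rw [edist_dist]
  refine ENNReal.ofReal_le_ofReal ?_
  rw [dist_eq_norm]
  generalize prox x = w at *
  -- The stationarity of `z` cancels the large term `μ⁻¹ • w`, leaving two gradient differences and
  -- the stage displacement.
  have e : ∇ (avg h) w - (∇ (avg g) w + μ⁻¹ • (x - w))
      = (∇ (avg h) w - ∇ (avg h) x) + (∇ (avg g) z - ∇ (avg g) w) + (μ⁻¹ + γ) • (z - x) := by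
    have : ∇ (avg h) x = ∇ (avg g) z + μ⁻¹ • z + γ • (z - x) - μ⁻¹ • w := by rw [hz]; abel
    rw [this]
    module
  rw [e]
  have h1 := hP.smooth_h.2 w x
  have h2 := hg.2 z w
  have h3 : ‖z - w‖ ≤ ‖x - z‖ + ‖x - w‖ := by
    have := norm_sub_le_norm_sub_add_norm_sub z x w
    rwa [norm_sub_rev z x] at this
  have hs : 0 < μ⁻¹ + γ := by positivity
  have hLs : L ≤ μ⁻¹ + γ := by
    have : L ≤ μ⁻¹ := by rw [← one_div, le_div_iff₀ hμ]; nlinarith [mul_pos hL hμ]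
    linarith
  have h4 : ‖(μ⁻¹ + γ) • (z - x)‖ = (μ⁻¹ + γ) * ‖x - z‖ := by
    rw [norm_smul, Real.norm_of_nonneg hs.le, norm_sub_rev]
  refine (norm_add₃_le).trans ?_
  rw [h4]
  rw [norm_sub_rev w x] at h1
  have h5 : L * ‖z - w‖ ≤ L * (‖x - z‖ + ‖x - w‖) := by gcongr
  have h6 : L * ‖x - z‖ ≤ (μ⁻¹ + γ) * ‖x - z‖ := by gcongr
  linarith

end Stage

/-! ### The inner loops, pathwise -/

section SVRG

variable [NeZero n₁] {L μ γ : ℝ} {g : Fin n₁ → Vec d → ℝ}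

/-- Every outcome of the inner loop stays close to the minimizer `z` of the majorant. -/
theorem mem_support_svrgInner (hL : 0 < L) (hμ : 0 < μ) (hγ : 0 ≤ γ)
    (hLμ : 1000 * (L * μ) ≤ 1) (hg : ∀ i, IsSmooth L (g i)) {u x xbar z : Vec d}
    (hz : IsStageMin μ γ g u x z) (t : ℕ) :
    ∀ o ∈ (svrgInner g (fun y => 1 / (2 * μ) * ‖y‖ ^ 2) γ (0.05 / L) x xbar
        ((n₁ : ℝ)⁻¹ • (∑ i, ∇ (g i) xbar) - u) t).support,
      ‖o.point - z‖ ≤ ‖xbar - z‖ ∧ ‖o.total - (t : ℝ) • z‖ ≤ t * (1 / 10 * ‖xbar - z‖) ∧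
        o.count = 2 * t := by
  induction t with
  | zero =>
    intro o ho
    rw [svrgInner, PMF.support_pure, Set.mem_singleton_iff] at ho
    subst ho
    simp
  | succ t ih =>
    intro o ho
    rw [svrgInner, PMF.mem_support_bind_iff] at ho
    obtain ⟨st, hst, ho⟩ := ho
    rw [PMF.mem_support_map_iff] at ho
    obtain ⟨i, -, rfl⟩ := ho
    obtain ⟨h1, h2, h3⟩ := ih st hst
    rw [← gradient_avg (fun i => (hg i).1)]
    dsimp only
    have hη : (0 : ℝ) < 0.05 / L := by positivity
    have key := argminPoint_quadratic hη hμ hγ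
      (∇ (g i) st.point - ∇ (g i) xbar + (∇ (avg g) xbar - u)) st.point x
    set y := argminPoint (fun y : Vec d =>
      inner ℝ (∇ (g i) st.point - ∇ (g i) xbar + (∇ (avg g) xbar - u)) (y - st.point)
        + 1 / (2 * (0.05 / L)) * ‖y - st.point‖ ^ 2
        + 1 / (2 * μ) * ‖y‖ ^ 2 + γ / 2 * ‖y - x‖ ^ 2) with hy
    have hη' : (0.05 / L)⁻¹ = 20 * L := by
      rw [inv_div]; norm_num; ring
    rw [hη'] at key
    have hm : 1000 * L ≤ μ⁻¹ := by rw [← one_div, le_div_iff₀ hμ]; linarith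
    have hs : 0 < 20 * L + μ⁻¹ + γ := by positivity
    -- The optimality condition of the step minus the stationarity of `z`. The right side has norm
    -- at most `(20 + 2 + 1) L ‖xbar - z‖`, and the factor on the left exceeds `230 L` since `μ⁻¹ ≥
    -- 1000 L`.
    have e : (20 * L + μ⁻¹ + γ) • (y - z) = (20 * L) • (st.point - z)
        - ((∇ (g i) st.point - ∇ (g i) xbar) + (∇ (avg g) xbar - ∇ (avg g) z)) := by
      rw [smul_sub, key]
      rw [IsStageMin] at hz
      rw [← hz]
      module
    have hR : ‖st.point - xbar‖ ≤ 2 * ‖xbar - z‖ := by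
      have := norm_sub_le_norm_sub_add_norm_sub st.point z xbar
      rw [norm_sub_rev z xbar] at this
      linarith
    have b1 : ‖∇ (g i) st.point - ∇ (g i) xbar‖ ≤ L * (2 * ‖xbar - z‖) :=
      ((hg i).2 _ _).trans (by gcongr)
    have b2 := (isSmooth_avg hg).2 xbar z
    have b3 : (20 * L + μ⁻¹ + γ) * ‖y - z‖ ≤ 23 * L * ‖xbar - z‖ := by
      rw [← Real.norm_of_nonneg hs.le, ← norm_smul, e]
      refine (norm_sub_le _ _).trans ?_
      have b4 : ‖(20 * L) • (st.point - z)‖ ≤ 20 * L * ‖xbar - z‖ := by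
        rw [norm_smul, Real.norm_of_nonneg (by positivity)]; gcongr
      have := norm_add_le (∇ (g i) st.point - ∇ (g i) xbar) (∇ (avg g) xbar - ∇ (avg g) z)
      linarith
    have b5 : ‖y - z‖ ≤ 1 / 10 * ‖xbar - z‖ := by
      have h6 : (230 * L) * ‖y - z‖ ≤ (20 * L + μ⁻¹ + γ) * ‖y - z‖ := by
        gcongr; linarith
      have h7 : (230 * L) * ‖y - z‖ ≤ (230 * L) * (1 / 10 * ‖xbar - z‖) := by linarith
      exact le_of_mul_le_mul_left h7 (by positivity)
    refine ⟨b5.trans (by linarith [norm_nonneg (xbar - z)]), ?_, by rw [h3]; ring⟩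
    have e2 : st.total + y - ((t + 1 : ℕ) : ℝ) • z = (st.total - (t : ℝ) • z) + (y - z) := by
      push_cast; module
    rw [e2]
    refine (norm_add_le _ _).trans ?_
    push_cast
    linarith

/-- Every outcome of `S` outer loops of SVRG. -/
theorem mem_support_svrg (hL : 0 < L) (hμ : 0 < μ) (hγ : 0 ≤ γ)
    (hLμ : 1000 * (L * μ) ≤ 1) (hg : ∀ i, IsSmooth L (g i)) (n₂ : ℕ) {dh : Vec d → Vec d}
    {x z : Vec d} (hz : IsStageMin μ γ g (dh x) x z) {T : ℕ} (hT : T ≠ 0) (S : ℕ) :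
    ∀ o ∈ (svrg g n₂ dh (fun y => 1 / (2 * μ) * ‖y‖ ^ 2) γ (0.05 / L) T x S).support,
      ‖o.1 - z‖ ≤ (1 / 10) ^ S * ‖x - z‖ ∧ (S = 0 → o.1 = x) ∧
        o.2 = S * (n₁ + n₂ + 2 * T) := by
  induction S with
  | zero =>
    intro o ho
    rw [svrg, PMF.support_pure, Set.mem_singleton_iff] at ho
    subst ho
    simp
  | succ S ih =>
    intro o ho
    rw [svrg, PMF.mem_support_bind_iff] at ho
    obtain ⟨st, hst, ho⟩ := ho
    rw [PMF.mem_support_map_iff] at ho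
    obtain ⟨i, hi, rfl⟩ := ho
    obtain ⟨h1, -, h3⟩ := ih st hst
    obtain ⟨-, h4, h5⟩ := mem_support_svrgInner hL hμ hγ hLμ hg hz T i hi
    refine ⟨?_, by simp, ?_⟩
    · have hT' : (0 : ℝ) < T := by exact_mod_cast Nat.pos_of_ne_zero hT
      have e : (T : ℝ)⁻¹ • i.total - z = (T : ℝ)⁻¹ • (i.total - (T : ℝ) • z) := by
        rw [smul_sub, inv_smul_smul₀ hT'.ne']
      dsimp only
      rw [e, norm_smul, Real.norm_of_nonneg (by positivity)]
      calc (T : ℝ)⁻¹ * ‖i.total - (T : ℝ) • z‖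
          ≤ (T : ℝ)⁻¹ * (T * (1 / 10 * ((1 / 10) ^ S * ‖x - z‖))) := by
            gcongr
            exact h4.trans (by gcongr)
        _ = (1 / 10) ^ (S + 1) * ‖x - z‖ := by rw [pow_succ]; field_simp
    · dsimp only
      rw [h3, h5]; ring

end SVRG

/-! ### Expectations -/

theorem expect_le {Ω : Type} {p : PMF Ω} {φ : Ω → ℝ≥0∞} {c : ℝ≥0∞}
    (hφ : ∀ ω ∈ p.support, φ ω ≤ c) : expect p φ ≤ c := by
  calc expect p φ ≤ ∑' ω, p ω * c := by
        refine ENNReal.tsum_le_tsum fun ω => ?_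
        by_cases hω : p ω = 0
        · simp [hω]
        · gcongr
          exact hφ ω ((PMF.mem_support_iff _ _).mpr hω)
    _ = c := by rw [ENNReal.tsum_mul_right, p.tsum_coe, one_mul]

theorem expect_bind {Ω Ω' : Type} (p : PMF Ω) (f : Ω → PMF Ω') (φ : Ω' → ℝ≥0∞) :
    expect (p.bind f) φ = expect p fun ω => expect (f ω) φ := by
  simp only [expect, PMF.bind_apply, ← ENNReal.tsum_mul_right, ← ENNReal.tsum_mul_left]
  rw [ENNReal.tsum_comm]
  simp only [mul_assoc]

theorem expect_pure {Ω : Type} (a : Ω) (φ : Ω → ℝ≥0∞) : expect (PMF.pure a) φ = φ a := by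
  rw [expect, tsum_eq_single a (fun b hb => by rw [PMF.pure_apply_of_ne _ _ hb, zero_mul]),
    PMF.pure_apply_self, one_mul]

theorem expect_map {Ω Ω' : Type} (p : PMF Ω) (f : Ω → Ω') (φ : Ω' → ℝ≥0∞) :
    expect (p.map f) φ = expect p fun ω => φ (f ω) := by
  rw [PMF.map, expect_bind]
  simp only [Function.comp_apply, expect_pure]

/-- Pair `j` with `K - 1 - j`: the bases `j + 1` and `K - j` add up to `K + 1`, so one of them is at
least `K/2`. -/
theorem mul_rpow_le_sum_rpow {α : ℝ} (hα : 1 ≤ α) (K : ℕ) :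
    (K : ℝ) * (K : ℝ) ^ α ≤ 2 ^ (α + 1) * ∑ j ∈ Finset.range K, ((j : ℝ) + 1) ^ α := by
  have h1 : ∀ j ∈ Finset.range K,
      ((K : ℝ) / 2) ^ α ≤ ((j : ℝ) + 1) ^ α + (((K - 1 - j : ℕ) : ℝ) + 1) ^ α := by
    intro j hj
    rw [Finset.mem_range] at hj
    have e : ((K - 1 - j : ℕ) : ℝ) = K - 1 - j := by
      rw [Nat.sub_sub, Nat.cast_sub (by omega)]; push_cast; ring
    rw [e]
    have hjK : (j : ℝ) + 1 ≤ K := by exact_mod_cast hj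
    have hK0 : (0 : ℝ) ≤ K / 2 := by positivity
    rcases le_total ((K : ℝ) / 2) (j + 1) with hle | hle
    · have := Real.rpow_le_rpow hK0 hle (by linarith : 0 ≤ α)
      have h0 : 0 ≤ ((K : ℝ) - 1 - j + 1) ^ α := Real.rpow_nonneg (by linarith) _
      linarith
    · have := Real.rpow_le_rpow hK0 (by linarith : (K : ℝ) / 2 ≤ K - 1 - j + 1)
        (by linarith : 0 ≤ α)
      have h0 : 0 ≤ ((j : ℝ) + 1) ^ α := by positivity
      linarith
  have h2 := Finset.sum_le_sum h1
  rw [Finset.sum_const, Finset.card_range, nsmul_eq_mul, Finset.sum_add_distrib,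
    Finset.sum_range_reflect (fun j : ℕ => ((j : ℝ) + 1) ^ α) K,
    Real.div_rpow (by positivity) (by norm_num)] at h2
  have h3 : (0 : ℝ) < 2 ^ α := by positivity
  rw [Real.rpow_add_one (by norm_num)]
  rw [mul_div_assoc', div_le_iff₀ h3] at h2
  linarith

theorem tauLaw_le {K : ℕ} [NeZero K] {α : ℝ} (hα : 1 ≤ α) (i : Fin K) :
    tauLaw K α i ≤ ENNReal.ofReal (2 ^ (α + 1) / K) := by
  have hK : (0 : ℝ) < K := by exact_mod_cast Nat.pos_of_ne_zero (NeZero.ne K)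
  rw [tauLaw, PMF.normalize_apply, tsum_fintype, ← ENNReal.ofReal_sum_of_nonneg
    (fun _ _ => by positivity), Fin.sum_univ_eq_sum_range (fun j : ℕ => ((j : ℝ) + 1) ^ α) K]
  have h1 := mul_rpow_le_sum_rpow hα K
  have hKα : 0 < (K : ℝ) ^ α := by positivity
  have h2 : 0 < ∑ j ∈ Finset.range K, ((j : ℝ) + 1) ^ α := by
    have : 0 < (2 : ℝ) ^ (α + 1) := by positivity
    exact pos_of_mul_pos_right ((mul_pos hK hKα).trans_le h1) this.le
  rw [← ENNReal.ofReal_inv_of_pos h2, ← ENNReal.ofReal_mul (by positivity)]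
  refine ENNReal.ofReal_le_ofReal ?_
  rw [← div_eq_mul_inv, div_le_div_iff₀ h2 hK]
  have h3 : ((i : ℕ) + 1 : ℝ) ^ α ≤ (K : ℝ) ^ α := by
    refine Real.rpow_le_rpow (by positivity) ?_ (by linarith)
    exact_mod_cast i.2
  nlinarith

/-- An expectation under the law of the output index, bounded through a plain average. -/
theorem expect_tauLaw_le {K : ℕ} [NeZero K] {α : ℝ} (hα : 1 ≤ α) {φ : Fin K → ℝ≥0∞} {A : ℝ}
    {q : ℕ → ℝ} (hA : 0 ≤ A) (hq : ∀ k < K, 0 ≤ q k)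
    (hφ : ∀ i : Fin K, φ i ≤ ENNReal.ofReal (A + q i)) :
    expect (tauLaw K α) φ
      ≤ ENNReal.ofReal (A + 2 ^ (α + 1) / K * ∑ k ∈ Finset.range K, q k) := by
  have hs : 0 ≤ ∑ k ∈ Finset.range K, q k :=
    Finset.sum_nonneg fun k hk => hq k (Finset.mem_range.mp hk)
  have hprob : ∑ i, tauLaw K α i = 1 := by
    rw [← tsum_fintype (L := .unconditional _)]
    exact (tauLaw K α).tsum_coe
  rw [ENNReal.ofReal_add hA (by positivity), ENNReal.ofReal_mul (by positivity), expect,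
    tsum_fintype]
  -- The constant `A` is weighted by the total mass one; only `q` pays the factor `2^{α+1}` for
  -- passing to a plain average.
  calc ∑ i, tauLaw K α i * φ i
      ≤ ∑ i : Fin K, (tauLaw K α i * ENNReal.ofReal A
          + ENNReal.ofReal (2 ^ (α + 1) / K) * ENNReal.ofReal (q i)) := by
        refine Finset.sum_le_sum fun i _ => ?_
        refine (mul_le_mul_right (hφ i) _).trans ?_
        rw [ENNReal.ofReal_add hA (hq i i.2), mul_add]
        gcongr
        exact tauLaw_le hα i
    _ = _ := by
        rw [Finset.sum_add_distrib, ← Finset.sum_mul, hprob, one_mul, ← Finset.mul_sum,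
          ← Fin.sum_univ_eq_sum_range q K,
          ENNReal.ofReal_sum_of_nonneg (fun (i : Fin K) _ => hq i i.2)]

/-! ### The stages, pathwise -/

/-- A relation between the end points of each stage, and the cost of each stage, hold along every
run. -/
theorem mem_support_stages [NeZero n₁] {g : Fin n₁ → Vec d → ℝ} {h : Fin n₂ → Vec d → ℝ} {μ η : ℝ}
    {prox : Vec d → Vec d} {γ : ℕ → ℝ} {T S : ℕ → ℕ} {x₁ : Vec d}
    {R : ℕ → Vec d → Vec d → Prop} {c : ℕ → ℕ} (K : ℕ)
    (hR : ∀ k < K, ∀ x, ∀ o ∈ (svrg g n₂ (subgrad h μ prox) (fun y => 1 / (2 * μ) * ‖y‖ ^ 2)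
      (γ (k + 1)) η (T (k + 1)) x (S (k + 1))).support, R k x o.1 ∧ o.2 = c k) :
    ∀ o ∈ (stages g h μ prox γ η T S x₁ K).support,
      o.1 1 = x₁ ∧ (∀ k < K, R k (o.1 (k + 1)) (o.1 (k + 2))) ∧
        o.2 = ∑ k ∈ Finset.range K, c k := by
  induction K with
  | zero =>
    intro o ho
    rw [stages, PMF.support_pure, Set.mem_singleton_iff] at ho
    subst ho
    simp
  | succ K ih =>
    intro o ho
    rw [stages, PMF.mem_support_bind_iff] at ho
    obtain ⟨st, hst, ho⟩ := ho
    rw [PMF.mem_support_map_iff] at ho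
    obtain ⟨o', ho', rfl⟩ := ho
    obtain ⟨h1, h2, h3⟩ := ih (fun k hk => hR k (by omega)) st hst
    obtain ⟨h4, h5⟩ := hR K (by omega) _ o' ho'
    refine ⟨?_, fun k hk => ?_, ?_⟩
    · dsimp only
      rw [Function.update_of_ne (by omega), h1]
    · dsimp only
      rw [Function.update_of_ne (by omega)]
      rcases Nat.lt_succ_iff_lt_or_eq.mp hk with hk | rfl
      · rw [Function.update_of_ne (by omega)]
        exact h2 k hk
      · rw [Function.update_self]
        exact h4
    · dsimp only
      rw [h3, h5, Finset.sum_range_succ]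

/-- What a stage with `S` outer loops achieves. -/
theorem svrg_stage [NeZero n₁] {L μ γ : ℝ} {g : Fin n₁ → Vec d → ℝ} {h : Fin n₂ → Vec d → ℝ}
    {r : Vec d → EReal} {prox : Vec d → Vec d} (hL : 0 < L) (hμ : 0 < μ) (hγ : 0 ≤ γ)
    (hLμ : 1000 * (L * μ) ≤ 1) (hP : IsProblem L g h r) (hprox : ∀ x, prox x ∈ proxSet μ r x)
    {T : ℕ} (hT : T ≠ 0) (S : ℕ) (x : Vec d) :
    ∀ o ∈ (svrg g n₂ (subgrad h μ prox) (fun y => 1 / (2 * μ) * ‖y‖ ^ 2) γ (0.05 / L) T x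
        S).support,
      (∃ q : ℝ, 0 ≤ q ∧
        criticality (avg g) (avg h) r (prox x) ≤ ENNReal.ofReal (2 * L * ‖x - prox x‖ + q) ∧
        (∃ y, q ^ 2 ≤ 16 * (μ⁻¹ + γ) * (objective μ g h r prox x - objective μ g h r prox y)) ∧
        (S ≠ 0 → q ^ 2 ≤
          16 * (μ⁻¹ + γ) * (objective μ g h r prox x - objective μ g h r prox o.1)) ∧
        (S = 0 → o.1 = x)) ∧
      o.2 = S * (n₁ + n₂ + 2 * T) := by
  intro o ho
  obtain ⟨z, hz⟩ := exists_isStageMin hL hμ hγ (by linarith) (isSmooth_avg hP.smooth_g)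
    (subgrad h μ prox x) x
  obtain ⟨h1, h2, h3⟩ := mem_support_svrg hL hμ hγ hLμ hP.smooth_g n₂ hz hT S o ho
  have hs : 0 < μ⁻¹ + γ := by positivity
  have hdesc : ∀ y, ‖y - z‖ ≤ 1 / 10 * ‖x - z‖ → (2 * ((μ⁻¹ + γ) * ‖x - z‖)) ^ 2
      ≤ 16 * (μ⁻¹ + γ) * (objective μ g h r prox x - objective μ g h r prox y) := by
    intro y hy
    have := objective_descent hμ hγ hLμ hP hprox hz hy
    calc (2 * ((μ⁻¹ + γ) * ‖x - z‖)) ^ 2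
        = 16 * (μ⁻¹ + γ) * ((μ⁻¹ + γ) / 4 * ‖x - z‖ ^ 2) := by ring
      _ ≤ _ := by gcongr
  -- The exact minimizer `z` serves as the comparison point, so `q` is controlled even when the
  -- stage has no outer loop.
  refine ⟨⟨2 * ((μ⁻¹ + γ) * ‖x - z‖), by positivity,
    criticality_prox_le hL hμ hγ hLμ hP hprox hz, ⟨z, hdesc z ?_⟩, fun hS => hdesc _ ?_, h2⟩, h3⟩
  · rw [sub_self, norm_zero]; positivity
  · refine h1.trans ?_
    gcongr
    calc ((1 : ℝ) / 10) ^ S ≤ (1 / 10) ^ 1 :=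
          pow_le_pow_of_le_one (by norm_num) (by norm_num) (Nat.one_le_iff_ne_zero.mpr hS)
      _ = 1 / 10 := pow_one _

/-- Telescoping along a run whose first step may be idle. -/
theorem sum_sq_le_of_descent {f q : ℕ → ℝ} {s Δ : ℝ} (hs : 0 < s) {K : ℕ}
    (hgap : ∀ k, f 0 ≤ f k + Δ) (h0 : q 0 ^ 2 ≤ s * Δ) (h01 : 0 < K → f 1 ≤ f 0)
    (hstep : ∀ k, 0 < k → k < K → q k ^ 2 ≤ s * (f k - f (k + 1))) :
    (∀ k ≤ K, f k ≤ f 0) ∧ ∑ k ∈ Finset.range K, q k ^ 2 ≤ 2 * s * Δ := by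
  have hΔ : 0 ≤ Δ := by linarith [hgap 0]
  have hmain : ∀ k ≤ K, f k ≤ f 0 ∧ ∑ j ∈ Finset.range k, q j ^ 2 ≤ s * Δ + s * (f 0 - f k) := by
    intro k
    induction k with
    | zero =>
      intro _
      refine ⟨le_rfl, ?_⟩
      simp only [Finset.range_zero, Finset.sum_empty]
      nlinarith [mul_nonneg hs.le hΔ]
    | succ k ih =>
      intro hk
      obtain ⟨h1, h2⟩ := ih (by omega)
      rw [Finset.sum_range_succ]
      -- The possibly idle step `0` pays `s Δ` by itself; the others telescope to at most another `s
      -- Δ`, whence the factor 2.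
      rcases Nat.eq_zero_or_pos k with rfl | hk0
      · have := h01 (by omega)
        refine ⟨this, ?_⟩
        simp only [Finset.range_zero, Finset.sum_empty, zero_add]
        nlinarith
      · have h3 := hstep k hk0 (by omega)
        have h4 : 0 ≤ f k - f (k + 1) :=
          nonneg_of_mul_nonneg_right ((sq_nonneg (q k)).trans h3) hs
        exact ⟨by linarith, by nlinarith⟩
  refine ⟨fun k hk => (hmain k hk).1, ?_⟩
  have h1 := (hmain K le_rfl).2
  have h2 : s * (f 0 - f K) ≤ s * Δ := by
    gcongr; linarith [hgap K]
  linarith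

theorem natCeil_logb_ne_zero {k : ℕ} (hk : 2 ≤ k) : ⌈Real.logb 2 (k : ℝ)⌉₊ ≠ 0 := by
  refine (Nat.ceil_pos.mpr (Real.logb_pos (by norm_num) ?_)).ne'
  exact_mod_cast hk

/-- In the definition the law of `τ - 1` is pushed forward to `ℕ` before the iterate is selected;
merging the two maps keeps the bound `i < K` available. -/
theorem ssdcSVRG_eq [NeZero n₁] (L : ℝ) (g : Fin n₁ → Vec d → ℝ) (h : Fin n₂ → Vec d → ℝ)
    (μ : ℝ) (prox : Vec d → Vec d) (γ : ℕ → ℝ) (T : ℕ → ℕ) (α : ℝ) (x₁ : Vec d)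
    (K : ℕ) [NeZero K] :
    ssdcSVRG L g h μ prox γ T α x₁ K =
      (stages g h μ prox γ (0.05 / L) T (fun k => ⌈Real.logb 2 k⌉₊) x₁ K).bind fun st =>
        PMF.map (fun i : Fin K => (st.1 ((i : ℕ) + 1), st.2)) (tauLaw K α) := by
  rw [ssdcSVRG]
  congr 1
  funext st
  exact PMF.map_comp (fun i : Fin K => (i : ℕ)) (tauLaw K α) fun i => (st.1 (i + 1), st.2)

/-- Complexity of SSDC-SVRG in terms of the deterministic data of a problem: the displacement
`‖x - prox x‖` on the initial sublevel set and the size of `1/μ + γ_k`. -/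
theorem ssdcSVRG_bounds [NeZero n₁] {L μ Δ ε E D α : ℝ} {g : Fin n₁ → Vec d → ℝ}
    {h : Fin n₂ → Vec d → ℝ} {r : Vec d → EReal} {prox : Vec d → Vec d} {γ : ℕ → ℝ} {T : ℕ → ℕ}
    {x₁ : Vec d} {K : ℕ} [NeZero K]
    (hL : 0 < L) (hμ : 0 < μ) (hLμ : 1000 * (L * μ) ≤ 1) (hα : 1 ≤ α) (hε : 0 < ε) (hE : 0 ≤ E)
    (hP : IsProblem L g h r) (hprox : ∀ x, prox x ∈ proxSet μ r x)
    (hγ : ∀ k < K, 0 ≤ γ (k + 1)) (hT : ∀ k < K, T (k + 1) ≠ 0)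
    (hσ : ∀ k < K, μ⁻¹ + γ (k + 1) ≤ D * ε ^ 2 * K)
    (hgap : ∀ x, objective μ g h r prox x₁ ≤ objective μ g h r prox x + Δ)
    (hdisp : ∀ x, objective μ g h r prox x ≤ objective μ g h r prox x₁ → ‖x - prox x‖ ≤ E * ε) :
    expect (ssdcSVRG L g h μ prox γ T α x₁ K) (fun o => ‖o.1 - prox o.1‖ₑ)
      ≤ ENNReal.ofReal (E * ε) ∧
    expect (ssdcSVRG L g h μ prox γ T α x₁ K)
        (fun o => criticality (avg g) (avg h) r (prox o.1))
      ≤ ENNReal.ofReal ((2 * L * E + 2 ^ (α + 1) * (1 / 2 + 16 * D * Δ)) * ε) ∧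
    ∀ o ∈ (ssdcSVRG L g h μ prox γ T α x₁ K).support,
      o.2 = ∑ k ∈ Finset.range K,
        ⌈Real.logb 2 ((k + 1 : ℕ) : ℝ)⌉₊ * (n₁ + n₂ + 2 * T (k + 1)) := by
  have hKpos : 0 < K := Nat.pos_of_ne_zero (NeZero.ne K)
  have hK : (0 : ℝ) < K := by exact_mod_cast hKpos
  set F := objective μ g h r prox with hF
  have hσ0 : 0 < D * ε ^ 2 * K := by
    have := hσ 0 hKpos
    have := hγ 0 hKpos
    have : 0 < μ⁻¹ := by positivity
    linarith
  have hpath := mem_support_stages (x₁ := x₁) (γ := γ) (T := T)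
    (S := fun k => ⌈Real.logb 2 (k : ℝ)⌉₊)
    (R := fun k x y => ∃ q : ℝ, 0 ≤ q ∧
      criticality (avg g) (avg h) r (prox x) ≤ ENNReal.ofReal (2 * L * ‖x - prox x‖ + q) ∧
      (∃ y, q ^ 2 ≤ 16 * (μ⁻¹ + γ (k + 1)) * (F x - F y)) ∧
      (⌈Real.logb 2 ((k + 1 : ℕ) : ℝ)⌉₊ ≠ 0 →
        q ^ 2 ≤ 16 * (μ⁻¹ + γ (k + 1)) * (F x - F y)) ∧
      (⌈Real.logb 2 ((k + 1 : ℕ) : ℝ)⌉₊ = 0 → y = x))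
    (c := fun k => ⌈Real.logb 2 ((k + 1 : ℕ) : ℝ)⌉₊ * (n₁ + n₂ + 2 * T (k + 1))) K fun k hk x =>
    svrg_stage hL hμ (hγ k hk) hLμ hP hprox (hT k hk) (⌈Real.logb 2 ((k + 1 : ℕ) : ℝ)⌉₊) x
  have hrun : ∀ st ∈ (stages g h μ prox γ (0.05 / L) T (fun k => ⌈Real.logb 2 k⌉₊) x₁ K).support,
      (∀ k < K, ‖st.1 (k + 1) - prox (st.1 (k + 1))‖ ≤ E * ε) ∧
      ∃ q : ℕ → ℝ, (∀ k < K, 0 ≤ q k ∧ criticality (avg g) (avg h) r (prox (st.1 (k + 1)))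
          ≤ ENNReal.ofReal (2 * L * (E * ε) + q k)) ∧
        ∑ k ∈ Finset.range K, q k ^ 2 ≤ 2 * (16 * (D * ε ^ 2 * K)) * Δ := by
    intro st hst
    obtain ⟨h1, h2, -⟩ := hpath st hst
    choose! q hq0 hqc hqy hqS hS0 using h2
    -- Telescoping needs one common factor; enlarging it is harmless since the decrease of `F` is
    -- nonnegative.
    have hmono : ∀ k < K, ∀ y, q k ^ 2 ≤ 16 * (μ⁻¹ + γ (k + 1)) * (F (st.1 (k + 1)) - F y) →
        q k ^ 2 ≤ 16 * (D * ε ^ 2 * K) * (F (st.1 (k + 1)) - F y) := by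
      intro k hk y hy
      have h3 : 0 < μ⁻¹ + γ (k + 1) := by have := hγ k hk; positivity
      have h4 : 0 ≤ F (st.1 (k + 1)) - F y :=
        nonneg_of_mul_nonneg_right ((sq_nonneg (q k)).trans hy) (by positivity)
      refine hy.trans ?_
      gcongr
      exact hσ k hk
    obtain ⟨hF1, hsum⟩ := sum_sq_le_of_descent (f := fun k => F (st.1 (k + 1))) (q := q)
      (s := 16 * (D * ε ^ 2 * K)) (Δ := Δ) (K := K) (by positivity)
      (fun k => by simpa only [zero_add, h1] using hgap (st.1 (k + 1)))
      (by
        obtain ⟨y, hy⟩ := hqy 0 hKpos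
        refine (hmono 0 hKpos y hy).trans ?_
        gcongr
        rw [zero_add, h1]
        linarith [hgap y])
      -- Stage 1 has `⌈log₂ 1⌉ = 0` outer loops, so `x₂ = x₁`.
      (fun _ => by
        have := hS0 0 hKpos (by simp)
        simp only [zero_add] at this ⊢
        rw [one_add_one_eq_two, this])
      (fun k hk0 hk => hmono k hk _ (hqS k hk (natCeil_logb_ne_zero (by omega))))
    have hd : ∀ k < K, ‖st.1 (k + 1) - prox (st.1 (k + 1))‖ ≤ E * ε := fun k hk =>
      hdisp _ (by simpa only [zero_add, h1] using hF1 k hk.le)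
    refine ⟨hd, q, fun k hk => ⟨hq0 k hk, (hqc k hk).trans (ENNReal.ofReal_le_ofReal ?_)⟩, hsum⟩
    have := hd k hk
    gcongr
  refine ⟨?_, ?_, ?_⟩
  · rw [ssdcSVRG_eq, expect_bind]
    refine expect_le fun st hst => ?_
    rw [expect_map]
    refine expect_le fun i _ => ?_
    rw [← ofReal_norm]
    exact ENNReal.ofReal_le_ofReal ((hrun st hst).1 i i.2)
  · rw [ssdcSVRG_eq, expect_bind]
    refine expect_le fun st hst => ?_
    obtain ⟨-, q, hq, hsum⟩ := hrun st hst
    rw [expect_map]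
    refine (expect_tauLaw_le hα (A := 2 * L * (E * ε)) (q := q) (by positivity)
      (fun k hk => (hq k hk).1) (fun i => (hq i i.2).2)).trans (ENNReal.ofReal_le_ofReal ?_)
    -- Young's inequality with weight `ε` turns a mean square of order `ε²` into a mean of order
    -- `ε`.
    have hamgm : ∑ k ∈ Finset.range K, q k ≤ K * (ε / 2) + (2 * ε)⁻¹ *
        ∑ k ∈ Finset.range K, q k ^ 2 := by
      have : ∀ k ∈ Finset.range K, q k ≤ ε / 2 + (2 * ε)⁻¹ * q k ^ 2 := by
        intro k _
        have e : ε / 2 + (2 * ε)⁻¹ * q k ^ 2 - q k = (2 * ε)⁻¹ * (q k - ε) ^ 2 := by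
          field_simp; ring
        have : 0 ≤ (2 * ε)⁻¹ * (q k - ε) ^ 2 := by positivity
        linarith
      refine (Finset.sum_le_sum this).trans_eq ?_
      rw [Finset.sum_add_distrib, Finset.sum_const, Finset.card_range, nsmul_eq_mul,
        Finset.mul_sum]
    have h1 : ∑ k ∈ Finset.range K, q k
        ≤ K * (ε / 2) + (2 * ε)⁻¹ * (2 * (16 * (D * ε ^ 2 * K)) * Δ) :=
      hamgm.trans (by gcongr)
    calc 2 * L * (E * ε) + 2 ^ (α + 1) / K * ∑ k ∈ Finset.range K, q k
        ≤ 2 * L * (E * ε) + 2 ^ (α + 1) / K *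
          (K * (ε / 2) + (2 * ε)⁻¹ * (2 * (16 * (D * ε ^ 2 * K)) * Δ)) := by gcongr
      _ = _ := by field_simp
  · intro o ho
    rw [ssdcSVRG_eq, PMF.mem_support_bind_iff] at ho
    obtain ⟨st, hst, ho⟩ := ho
    rw [PMF.mem_support_map_iff] at ho
    obtain ⟨i, -, rfl⟩ := ho
    exact (hpath st hst).2.2

/-! ### Consequences of the assumptions on the problem -/

section Assumptions

variable {L μ : ℝ} {g : Fin n₁ → Vec d → ℝ} {h : Fin n₂ → Vec d → ℝ} {r : Vec d → EReal}
  {prox : Vec d → Vec d} {x₁ : Vec d}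

theorem objective_gap {μ₀ Δ : ℝ} (hP : IsProblem L g h r) (hprox : ∀ x, prox x ∈ proxSet μ r x)
    (hgap : InitialGap μ₀ Δ (avg g) (avg h) r x₁) (hμ : 0 < μ) (hμ₀ : μ ≤ μ₀) (x : Vec d) :
    objective μ g h r prox x₁ ≤ objective μ g h r prox x + Δ := by
  have h1 := hgap μ hμ hμ₀ x
  rw [smoothed, smoothed, moreau_eq_envelope hP.ne_bot_r hP.proper_r hprox,
    moreau_eq_envelope hP.ne_bot_r hP.proper_r hprox] at h1
  exact_mod_cast h1

/-- Testing the proximal problem with `x` itself bounds `‖x - prox x‖² / (2μ)` by `r x - r (prox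
x)`, hence by `G ‖x - prox x‖`. -/
theorem norm_sub_prox_le_of_isLipschitz {G : ℝ} (hG : 0 ≤ G) (hμ : 0 < μ)
    (hP : IsProblem L g h r) (hr : IsLipschitz G r)
    (hprox : ∀ x, prox x ∈ proxSet μ r x) (x : Vec d) : ‖x - prox x‖ ≤ 2 * G * μ := by
  have hw := apply_ne_top_of_mem_proxSet hP.proper_r (hprox x)
  have hx : r x ≠ ⊤ := fun hx => by
    have := hr x (prox x)
    rw [hx, top_le_iff] at this
    exact EReal.add_ne_top hw (EReal.coe_ne_top _) this
  have h1 := envelope_le hP.ne_bot_r hP.proper_r hprox x x hx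
  have h2 := hr x (prox x)
  rw [← EReal.coe_toReal hx (hP.ne_bot_r x), ← EReal.coe_toReal hw (hP.ne_bot_r _)] at h2
  norm_cast at h2
  rw [envelope, sub_self, norm_zero, norm_sub_rev] at h1
  have h3 : ‖x - prox x‖ ^ 2 / (2 * μ) ≤ G * ‖x - prox x‖ := by
    have : (0 : ℝ) ^ 2 / (2 * μ) = 0 := by simp
    linarith
  rw [div_le_iff₀ (by positivity)] at h3
  rcases (norm_nonneg (x - prox x)).eq_or_lt' with h0 | h0
  · rw [h0]; positivity
  · nlinarith

/-- With `w = prox x`, the envelope for `μ` contains `‖w - x‖² / (2μ)`, while `w` as a competitor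
for `2μ` costs only half of that. Using the gap hypothesis at `2μ`, the other half is bounded by `Δ
+ M`. -/
theorem norm_sub_prox_sq_le {μ₀ Δ M : ℝ} (hμ : 0 < μ) (hμ₀ : 2 * μ ≤ μ₀)
    (hP : IsProblem L g h r) (hprox : ∀ x, prox x ∈ proxSet μ r x)
    (hgap : InitialGap μ₀ Δ (avg g) (avg h) r x₁) (hx₁ : r x₁ ≠ ⊤)
    (hM : ∀ x, r x₁ ≤ r x + (M : EReal)) {x : Vec d}
    (hx : objective μ g h r prox x ≤ objective μ g h r prox x₁) :
    ‖x - prox x‖ ^ 2 ≤ 4 * μ * (Δ + M) := by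
  have hw := apply_ne_top_of_mem_proxSet hP.proper_r (hprox x)
  have hlow : (((r x₁).toReal - M : ℝ) : EReal) ≤ moreau (2 * μ) r x₁ := by
    refine le_iInf fun y => ?_
    rw [proxObjective]
    by_cases hy : r y = ⊤
    · rw [hy, EReal.coe_add_top]; exact le_top
    have h1 := hM y
    rw [← EReal.coe_toReal hy (hP.ne_bot_r y)] at h1 ⊢
    rw [← EReal.coe_toReal hx₁ (hP.ne_bot_r x₁)] at h1
    norm_cast at h1 ⊢
    have : 0 ≤ ‖y - x₁‖ ^ 2 / (2 * (2 * μ)) := by positivity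
    linarith
  have hup : moreau (2 * μ) r x
      ≤ ((‖prox x - x‖ ^ 2 / (2 * (2 * μ)) + (r (prox x)).toReal : ℝ) : EReal) := by
    rw [EReal.coe_add, EReal.coe_toReal hw (hP.ne_bot_r _)]
    exact iInf_le _ _
  have h1 := hgap (2 * μ) (by positivity) hμ₀ x
  rw [smoothed, smoothed] at h1
  have h2 : ((avg g x₁ - avg h x₁ : ℝ) : EReal) + (((r x₁).toReal - M : ℝ) : EReal)
      ≤ ((avg g x - avg h x : ℝ) : EReal) +
        ((‖prox x - x‖ ^ 2 / (2 * (2 * μ)) + (r (prox x)).toReal : ℝ) : EReal) + (Δ : EReal) := by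
    refine (add_le_add_right hlow _).trans (h1.trans ?_)
    gcongr
  norm_cast at h2
  have h3 := envelope_le hP.ne_bot_r hP.proper_r hprox x₁ x₁ hx₁
  have h0 : (0 : ℝ) ^ 2 / (2 * μ) = 0 := by simp
  rw [sub_self, norm_zero, h0] at h3
  simp only [objective] at hx
  rw [envelope.eq_def μ r prox x] at hx
  have h4 : ‖prox x - x‖ ^ 2 / (2 * μ)
      = ‖prox x - x‖ ^ 2 / (4 * μ) + ‖prox x - x‖ ^ 2 / (4 * μ) := by
    field_simp; ring
  have h5 : ‖prox x - x‖ ^ 2 / (2 * (2 * μ)) = ‖prox x - x‖ ^ 2 / (4 * μ) := by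
    ring_nf
  rw [h5] at h2
  rw [h4] at hx
  rw [norm_sub_rev]
  have h6 : ‖prox x - x‖ ^ 2 / (4 * μ) ≤ Δ + M := by linarith
  rw [div_le_iff₀ (by positivity)] at h6
  linarith

end Assumptions

/-! ### Gradient complexity -/

theorem sum_cost_le {B : ℝ} {K m : ℕ} (hK : 0 < K) {T : ℕ → ℕ}
    (hT : ∀ k < K, (T (k + 1) : ℝ) ≤ B * m) :
    ((∑ k ∈ Finset.range K, ⌈Real.logb 2 ((k + 1 : ℕ) : ℝ)⌉₊ * (m + 2 * T (k + 1)) : ℕ) : ℝ)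
      ≤ K * ((Real.logb 2 K + 1) * ((1 + 2 * |B|) * m)) := by
  push_cast
  have hlog0 : 0 ≤ Real.logb 2 K :=
    Real.logb_nonneg (by norm_num) (by exact_mod_cast hK)
  have h1 : ∀ k ∈ Finset.range K,
      (⌈Real.logb 2 ((k : ℝ) + 1)⌉₊ : ℝ) * ((m : ℝ) + 2 * (T (k + 1) : ℝ))
        ≤ (Real.logb 2 K + 1) * ((1 + 2 * |B|) * m) := by
    intro k hk
    rw [Finset.mem_range] at hk
    have hk1 : (1 : ℝ) ≤ (k : ℝ) + 1 := by linarith [Nat.cast_nonneg (α := ℝ) k]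
    have h2 : (⌈Real.logb 2 ((k : ℝ) + 1)⌉₊ : ℝ) ≤ Real.logb 2 K + 1 := by
      refine (Nat.ceil_lt_add_one (Real.logb_nonneg (by norm_num) hk1)).le.trans ?_
      have : Real.logb 2 ((k : ℝ) + 1) ≤ Real.logb 2 K :=
        Real.logb_le_logb_of_le (by norm_num) (by linarith) (by exact_mod_cast hk)
      linarith
    have h3 : (m : ℝ) + 2 * (T (k + 1) : ℝ) ≤ (1 + 2 * |B|) * m := by
      have h4 := hT k hk
      have h5 : B * m ≤ |B| * m := by gcongr; exact le_abs_self B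
      linarith
    gcongr
  refine (Finset.sum_le_sum h1).trans_eq ?_
  rw [Finset.sum_const, Finset.card_range, nsmul_eq_mul]

/-- As `log K ≤ log b + p log(1/ε)`, and `ε ≤ 1/2` gives `log(1/ε) ≥ log 2`, all additive constants
are absorbed into a multiple of `log(1/ε)`. -/
theorem cost_le {B b ε : ℝ} {K m p : ℕ} (hK : 0 < K) (hb : 1 ≤ b) (hε : 0 < ε)
    (hε2 : ε ≤ 1 / 2) (hKb : (K : ℝ) ≤ b / ε ^ p) :
    (K : ℝ) * ((Real.logb 2 K + 1) * ((1 + 2 * |B|) * m))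
      ≤ b * ((Real.log b + p) / Real.log 2 + 1) / Real.log 2 * (1 + 2 * |B|) * (m / ε ^ p)
        * Real.log (1 / ε) := by
  have hK' : (0 : ℝ) < K := by exact_mod_cast hK
  have hl2 : 0 < Real.log 2 := Real.log_pos (by norm_num)
  have hl2' : Real.log 2 ≤ 1 := by linarith [Real.log_two_lt_d9]
  have hb0 : 0 ≤ Real.log b := Real.log_nonneg hb
  have hlε : Real.log 2 ≤ Real.log (1 / ε) := by
    refine Real.log_le_log (by norm_num) ?_
    rw [le_div_iff₀ hε]; linarith
  have h1 : Real.log K ≤ Real.log b + p * Real.log (1 / ε) := by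
    refine (Real.log_le_log hK' hKb).trans_eq ?_
    rw [Real.log_div (by positivity) (by positivity), Real.log_pow, one_div, Real.log_inv]
    ring
  set l := Real.log (1 / ε)
  have hl : 1 ≤ l / Real.log 2 := by rwa [one_le_div hl2]
  have h2 : Real.logb 2 K + 1 ≤ ((Real.log b + p) / Real.log 2 + 1) / Real.log 2 * l := by
    have h3 : Real.log K ≤ (Real.log b + p) * (l / Real.log 2) := by
      have h4 : Real.log b ≤ Real.log b * (l / Real.log 2) := le_mul_of_one_le_right hb0 hl
      have h5 : l ≤ l / Real.log 2 := by
        rw [le_div_iff₀ hl2]; nlinarith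
      have h6 : p * l ≤ p * (l / Real.log 2) := by gcongr
      linarith
    have h7 : Real.logb 2 K ≤ (Real.log b + p) * (l / Real.log 2) / Real.log 2 := by
      rw [Real.logb]; gcongr
    calc Real.logb 2 K + 1 ≤ (Real.log b + p) * (l / Real.log 2) / Real.log 2 + l / Real.log 2 :=
          add_le_add h7 hl
      _ = _ := by ring
  have h0 : 0 ≤ Real.logb 2 K + 1 := by
    have := Real.logb_nonneg (b := 2) (by norm_num) (x := (K : ℝ)) (by exact_mod_cast hK)
    linarith
  calc (K : ℝ) * ((Real.logb 2 K + 1) * ((1 + 2 * |B|) * m))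
      ≤ b / ε ^ p * (((Real.log b + p) / Real.log 2 + 1) / Real.log 2 * l *
        ((1 + 2 * |B|) * m)) := by gcongr
    _ = _ := by ring

/-! ### Choice of parameters and the two cases of the theorem. -/

/-- The complexity theorem in terms of the exponents: `μ = ε ^ m`, `γ_k = c k ^ β`,
`K = Θ(1 / ε ^ (m + 2))`, where `β (m + 2) = m`. -/
theorem exists_ssdcSVRG_complexity (L c α Δ μ₀ E a b B β : ℝ) (m : ℕ) (hL : 0 < L) (hc : 0 < c)
    (hα : 1 ≤ α) (hΔ : 0 < Δ) (hμ₀ : 0 < μ₀) (hE : 0 ≤ E) (ha : 0 < a) (hm : m ≠ 0)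
    (hβ : β * (m + 2) = m) :
    ∃ ε₀ : ℝ, 0 < ε₀ ∧ ε₀ ≤ μ₀ ∧ ε₀ ≤ 1 / 2 ∧ ∃ C : ℝ, 0 < C ∧
      ∀ (d n₁ n₂ : ℕ) [NeZero n₁] [NeZero n₂] (g : Fin n₁ → Vec d → ℝ)
        (h : Fin n₂ → Vec d → ℝ) (r : Vec d → EReal) (x₁ : Vec d),
        IsProblem L g h r →
        InitialGap μ₀ Δ (avg g) (avg h) r x₁ →
        ∀ (ε : ℝ) (prox : Vec d → Vec d) (K : ℕ) [NeZero K] (T : ℕ → ℕ),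
          0 < ε → ε ≤ ε₀ →
          (∀ x, prox x ∈ proxSet (ε ^ m) r x) →
          (∀ x, objective (ε ^ m) g h r prox x ≤ objective (ε ^ m) g h r prox x₁ →
            ‖x - prox x‖ ≤ E * ε) →
          a / ε ^ (m + 2) ≤ K → K ≤ b / ε ^ (m + 2) →
          (∀ k ∈ Finset.Icc 1 K, (2 : ℝ) ≤ T k) →
          expect (ssdcSVRG L g h (ε ^ m) prox (fun k => c * (k : ℝ) ^ β) T α x₁ K)
              (fun o => ‖o.1 - prox o.1‖ₑ) ≤ ENNReal.ofReal (C * ε) ∧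
          expect (ssdcSVRG L g h (ε ^ m) prox (fun k => c * (k : ℝ) ^ β) T α x₁ K)
              (fun o => criticality (avg g) (avg h) r (prox o.1)) ≤ ENNReal.ofReal (C * ε) ∧
          ((∀ k ∈ Finset.Icc 1 K, (T k : ℝ) ≤ B * (n₁ + n₂)) →
            ∀ o ∈ (ssdcSVRG L g h (ε ^ m) prox (fun k => c * (k : ℝ) ^ β) T α x₁ K).support,
              (o.2 : ℝ) ≤ C * ((n₁ + n₂) / ε ^ (m + 2)) * Real.log (1 / ε)) := by
  have hβ0 : 0 ≤ β := by
    have h1 : (0 : ℝ) < (m : ℝ) + 2 := by positivity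
    exact (mul_nonneg_iff_of_pos_right h1).mp (by rw [hβ]; exact m.cast_nonneg)
  -- Enlarging `b` makes `log b'` nonnegative and the constants below positive.
  set b' := max b 1 with hb'
  have hb1 : 1 ≤ b' := le_max_right _ _
  set D := (1 + c * b' ^ β) / a with hD
  have hD0 : 0 < D := by positivity
  set C₂ := 2 * L * E + 2 ^ (α + 1) * (1 / 2 + 16 * D * Δ) with hC₂
  set C₃ := b' * ((Real.log b' + (m + 2 : ℕ)) / Real.log 2 + 1) / Real.log 2 * (1 + 2 * |B|)
    with hC₃
  have hC₂0 : 0 < C₂ := by positivity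
  -- Since `μ = ε^m ≤ ε`, the first two bounds give `1000 L μ ≤ 1` and `μ ≤ μ₀`; the third serves
  -- the logarithm in the cost.
  refine ⟨min (1 / (1000 * L)) (min μ₀ (1 / 2)), by positivity,
    (min_le_right _ _).trans (min_le_left _ _), (min_le_right _ _).trans (min_le_right _ _),
    max E (max C₂ C₃), lt_max_of_lt_right (lt_max_of_lt_left hC₂0), ?_⟩
  intro d n₁ n₂ _ _ g h r x₁ hP hgap ε prox K _ T hε hε₀ hprox hdisp hKa hKb hT
  have hεL := hε₀.trans (min_le_left _ _)
  have hεμ := hε₀.trans ((min_le_right _ _).trans (min_le_left _ _))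
  have hε2 := hε₀.trans ((min_le_right _ _).trans (min_le_right _ _))
  have hKpos : 0 < K := Nat.pos_of_ne_zero (NeZero.ne K)
  have hK : (0 : ℝ) < K := by exact_mod_cast hKpos
  have hKb' : (K : ℝ) ≤ b' / ε ^ (m + 2) := hKb.trans (by gcongr; exact le_max_left _ _)
  have hεm : ε ^ m ≤ ε := by
    simpa using pow_le_pow_of_le_one hε.le (by linarith) (Nat.one_le_iff_ne_zero.mpr hm)
  have hLμ : 1000 * (L * ε ^ m) ≤ 1 := by
    rw [le_div_iff₀ (by positivity)] at hεL
    have : L * ε ^ m ≤ L * ε := by gcongr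
    linarith
  have hσ : ∀ k < K, (ε ^ m)⁻¹ + c * ((k + 1 : ℕ) : ℝ) ^ β ≤ D * ε ^ 2 * K := by
    intro k hk
    -- The relation `β (m + 2) = m` balances the exponents: the largest `γ_k` has at most the order
    -- of `1/μ`.
    have h1 : ((k + 1 : ℕ) : ℝ) ^ β ≤ b' ^ β * (ε ^ m)⁻¹ := by
      calc ((k + 1 : ℕ) : ℝ) ^ β ≤ (b' / ε ^ (m + 2)) ^ β := by
            refine Real.rpow_le_rpow (by positivity) (le_trans ?_ hKb') hβ0
            exact_mod_cast hk
        _ = b' ^ β * (ε ^ m)⁻¹ := by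
            rw [Real.div_rpow (by positivity) (by positivity), ← Real.rpow_natCast ε (m + 2),
              ← Real.rpow_mul hε.le, div_eq_mul_inv, mul_comm _ β]
            push_cast
            rw [hβ, Real.rpow_natCast]
    calc (ε ^ m)⁻¹ + c * ((k + 1 : ℕ) : ℝ) ^ β ≤ (ε ^ m)⁻¹ + c * (b' ^ β * (ε ^ m)⁻¹) := by gcongr
      _ = D * ε ^ 2 * (a / ε ^ (m + 2)) := by rw [hD, pow_add]; field_simp
      _ ≤ D * ε ^ 2 * K := by gcongr
  obtain ⟨h1, h2, h3⟩ := ssdcSVRG_bounds (γ := fun k => c * (k : ℝ) ^ β) (T := T) (x₁ := x₁)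
    (K := K) hL (by positivity) hLμ hα hε hE hP hprox (fun k _ => by positivity)
    (fun k hk h0 => by
      have := hT (k + 1) (Finset.mem_Icc.mpr ⟨by omega, hk⟩)
      rw [h0] at this
      norm_num at this)
    hσ (objective_gap hP hprox hgap (by positivity) (hεm.trans hεμ)) hdisp
  refine ⟨h1.trans (ENNReal.ofReal_le_ofReal ?_), h2.trans (ENNReal.ofReal_le_ofReal ?_),
    fun hTB o ho => ?_⟩
  · gcongr; exact le_max_left _ _
  · gcongr; exact (le_max_left _ _).trans (le_max_right _ _)
  · rw [h3 o ho]
    have hcost := (sum_cost_le (B := B) (K := K) (m := n₁ + n₂) hKpos (T := T) fun k hk => by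
      exact_mod_cast hTB (k + 1) (Finset.mem_Icc.mpr ⟨by omega, hk⟩)).trans
      (cost_le hKpos hb1 hε hε2 hKb')
    refine hcost.trans ?_
    push_cast
    have hl : 0 ≤ Real.log (1 / ε) := Real.log_nonneg (by rw [le_div_iff₀ hε]; linarith)
    gcongr
    refine le_trans (le_of_eq ?_) ((le_max_right _ _).trans (le_max_right _ _))
    rw [hC₃]; push_cast; rfl

end SSDC

theorem mainTheorem3 :
    -- Part (a): `r` Lipschitz continuous, `μ = ε`, `γ_k = c k^{1/3}`, `K = Θ(1/ε³)`.
    (∀ L c α Δ μ₀ G a b B : ℝ, 0 < L → 0 < c → 1 ≤ α → 0 < Δ → 0 < μ₀ → 0 ≤ G → 0 < a →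
      ∃ ε₀ : ℝ, 0 < ε₀ ∧ ∃ C : ℝ, 0 < C ∧
        ∀ (d n₁ n₂ : ℕ) [NeZero n₁] [NeZero n₂] (g : Fin n₁ → SSDC.Vec d → ℝ)
          (h : Fin n₂ → SSDC.Vec d → ℝ) (r : SSDC.Vec d → EReal) (x₁ : SSDC.Vec d),
          SSDC.IsProblem L g h r →
          SSDC.InitialGap μ₀ Δ (SSDC.avg g) (SSDC.avg h) r x₁ →
          SSDC.IsLipschitz G r →
          ∀ (ε : ℝ) (prox : SSDC.Vec d → SSDC.Vec d) (K : ℕ) [NeZero K] (T : ℕ → ℕ),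
            0 < ε → ε ≤ ε₀ →
            (∀ x, prox x ∈ SSDC.proxSet ε r x) →
            a / ε ^ 3 ≤ K → K ≤ b / ε ^ 3 →
            (∀ k ∈ Finset.Icc 1 K,
              max 2 (200 * L / (c * (k : ℝ) ^ (1 / 3 : ℝ))) ≤ (T k : ℝ)) →
            let out := SSDC.ssdcSVRG L g h ε prox (fun k => c * (k : ℝ) ^ (1 / 3 : ℝ)) T α x₁ K
            SSDC.expect out (fun o => ‖o.1 - prox o.1‖ₑ) ≤ ENNReal.ofReal (C * ε) ∧
            SSDC.expect out
              (fun o => SSDC.criticality (SSDC.avg g) (SSDC.avg h) r (prox o.1))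
                ≤ ENNReal.ofReal (C * ε) ∧
            ((∀ k ∈ Finset.Icc 1 K, (T k : ℝ) ≤ B * (n₁ + n₂)) →
              ∀ o ∈ out.support, (o.2 : ℝ) ≤ C * ((n₁ + n₂) / ε ^ 3) * Real.log (1 / ε))) ∧
    -- Part (b): `r` lower bounded and finite-valued, or the level bounded case;
    -- `μ = ε²`, `γ_k = c k^{1/2}`, `K = Θ(1/ε⁴)`.
    (∀ L c α Δ μ₀ M a b B : ℝ, 0 < L → 0 < c → 1 ≤ α → 0 < Δ → 0 < μ₀ → 0 ≤ M → 0 < a →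
      ∃ ε₀ : ℝ, 0 < ε₀ ∧ ∃ C : ℝ, 0 < C ∧
        ∀ (d n₁ n₂ : ℕ) [NeZero n₁] [NeZero n₂] (g : Fin n₁ → SSDC.Vec d → ℝ)
          (h : Fin n₂ → SSDC.Vec d → ℝ) (r : SSDC.Vec d → EReal) (x₁ : SSDC.Vec d),
          SSDC.IsProblem L g h r →
          SSDC.InitialGap μ₀ Δ (SSDC.avg g) (SSDC.avg h) r x₁ →
          (SSDC.FiniteLowerBounded r ∨ SSDC.LevelBoundedCase (SSDC.avg g) (SSDC.avg h) r) →
          r x₁ ≠ ⊤ → (∀ x, r x₁ ≤ r x + (M : EReal)) →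
          ∀ (ε : ℝ) (prox : SSDC.Vec d → SSDC.Vec d) (K : ℕ) [NeZero K] (T : ℕ → ℕ),
            0 < ε → ε ≤ ε₀ →
            (∀ x, prox x ∈ SSDC.proxSet (ε ^ 2) r x) →
            a / ε ^ 4 ≤ K → K ≤ b / ε ^ 4 →
            (∀ k ∈ Finset.Icc 1 K,
              max 2 (200 * L / (c * (k : ℝ) ^ (1 / 2 : ℝ))) ≤ (T k : ℝ)) →
            let out :=
              SSDC.ssdcSVRG L g h (ε ^ 2) prox (fun k => c * (k : ℝ) ^ (1 / 2 : ℝ)) T α x₁ K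
            SSDC.expect out (fun o => ‖o.1 - prox o.1‖ₑ) ≤ ENNReal.ofReal (C * ε) ∧
            SSDC.expect out
              (fun o => SSDC.criticality (SSDC.avg g) (SSDC.avg h) r (prox o.1))
                ≤ ENNReal.ofReal (C * ε) ∧
            ((∀ k ∈ Finset.Icc 1 K, (T k : ℝ) ≤ B * (n₁ + n₂)) →
              ∀ o ∈ out.support, (o.2 : ℝ) ≤ C * ((n₁ + n₂) / ε ^ 4) * Real.log (1 / ε))) := by
  refine ⟨?_, ?_⟩
  · intro L c α Δ μ₀ G a b B hL hc hα hΔ hμ₀ hG ha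
    obtain ⟨ε₀, hε₀, -, -, C, hC, hmain⟩ := SSDC.exists_ssdcSVRG_complexity L c α Δ μ₀ (2 * G) a b B
      (1 / 3) 1 hL hc hα hΔ hμ₀ (by positivity) ha one_ne_zero (by norm_num)
    refine ⟨ε₀, hε₀, C, hC, ?_⟩
    intro d n₁ n₂ _ _ g h r x₁ hP hgap hr ε prox K _ T hε hε' hprox hKa hKb hT
    have := hmain d n₁ n₂ g h r x₁ hP hgap ε prox K T hε hε' (by simpa only [pow_one] using hprox)
      (fun x _ => SSDC.norm_sub_prox_le_of_isLipschitz hG hε hP hr hprox x) hKa hKb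
      (fun k hk => (le_max_left _ _).trans (hT k hk))
    simpa only [pow_one] using this
  · intro L c α Δ μ₀ M a b B hL hc hα hΔ hμ₀ hM ha
    obtain ⟨ε₀, hε₀, hεμ, hε2, C, hC, hmain⟩ := SSDC.exists_ssdcSVRG_complexity L c α Δ μ₀
      (2 * √(Δ + M)) a b B (1 / 2) 2 hL hc hα hΔ hμ₀ (by positivity) ha two_ne_zero (by norm_num)
    refine ⟨ε₀, hε₀, C, hC, ?_⟩
    intro d n₁ n₂ _ _ g h r x₁ hP hgap _ hx₁ hrM ε prox K _ T hε hε' hprox hKa hKb hT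
    refine hmain d n₁ n₂ g h r x₁ hP hgap ε prox K T hε hε' hprox (fun x hx => ?_) hKa hKb
      (fun k hk => (le_max_left _ _).trans (hT k hk))
    -- The envelope with parameter `2ε²` is admissible: `ε ≤ 1/2` gives `2ε² ≤ ε ≤ μ₀`.
    have h1 := SSDC.norm_sub_prox_sq_le (by positivity) (by nlinarith) hP hprox hgap hx₁ hrM hx
    refine le_of_sq_le_sq ?_ (by positivity)
    rw [mul_pow, mul_pow, Real.sq_sqrt (by linarith)]
    linarith
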